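/- **Theorem 4 (UAF authentication, client perspective).** *Models.* Consider FIDO UAF in the strand space model with a Dolev–Yao penetrator, in each of the twelve models UAF-NoBinding (over TLS 1.2-RSA, TLS 1.2-DH and TLS 1.3), UAF-TokenBinding, UAF-ChannelId, UAF-Endpoint, UAF-ServerCert (each over TLS 1.2-RSA and TLS 1.2-DH) and UAF-Exporter over TLS 1.3. The strand space of a model contains unboundedly many strands of the roles client-reg, server-reg, client-auth and server-auth (a TLS handshake with server certificate followed by UAF registration or authentication), of certificate authorities that issue the certificate of any name on request, and of the penetrator. In UAF authentication, after the handshake, the server sends $\{appid, challenge\}_{swk}$ and the client answers $\{fc, n, s\}_{cwk}$ with $fc=\mathrm{hash}(appid, challenge, tlsData)$ and $s=\{fc,n\}_{K_{priv}}$; $tlsData$ is the channel-binding data of the model, and $swk$, $cwk$ are the TLS write keys. In the DH models (TLS 1.2-DH and TLS 1.3) every server strand that uses a DH exponent generates it uniquely, as part of the server role. A bundle is a finite, causally closed, acyclic execution in which each received message has a unique transmission; the height of a strand in a bundle is the number of its events that have occurred. *Context and assumptions.* A client strand and a server strand *agree on the authentication session context* if they agree on $server$, $ca$, the client random $cr$,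 the server random $sr$, the premaster secret $pms$ (TLS 1.2-RSA) or both DH exponents $x,y$ (DH models), $challenge$ and $appid$. The *client assumptions* for a client-auth strand $s$ in a bundle are: the private keys of its certificate authority, its server and its authenticator are non-originating; $cr$ originates uniquely, on $s$; and $pms$ originates uniquely on $s$ (TLS 1.2-RSA), respectively the client's DH exponent is uniquely generated on $s$ (DH models). *Goal.* For a role $R$ and a number $j$ let $\mathrm{Succ}(R,j)$ state: in every bundle, for every client-auth strand $s$ that has completed all its events and satisfies the client assumptions, $R$ is complementary to client-auth (that is, a server role) and the bundle contains a strand of role $R$ of height at least $j$ that agrees with $s$ on the authentication session context. *Session context agreement* between client-auth and server-auth (Goal 1) means that for some $j\le \mathrm{height}(\text{server-auth})$, $\mathrm{Succ}(\text{server-auth},j)$ holds and, for all roles $R,R'$, $\mathrm{Succ}(R,j)\wedge\mathrm{Succ}(R',j)$ implies $R=R'$. *Claim.* In each of the twelve models session context agreement between client-auth and server-auth holds, and it holds with $j=\mathrm{height}(\text{server-auth})-1$, i.e. the server strand has executed everything but the reception of the client's last message. Moreover, for this $j$ the agreement is with a unique server strand: let $s$ be a completed client-auth strand of a bundle that satisfies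 the client assumptions and, for TLS 1.2-RSA, whose received $sr$ originates uniquely in the bundle and on a strand other than $s$. Then the bundle contains a server-auth strand $s'$ of height at least $j$ that agrees with $s$ on the context; no other server strand (server-auth or server-reg) of height at least $j$ agrees with $s$; and no other client strand (client-auth or client-reg) of the bundle agrees with $s'$. -/

import Mathlib

namespace UAF

/-! ## Message algebra -/

/-- String constants that separate the different uses of hashing, signing and encryption. -/
inductive Tag
  | emptyExtension
  | unbound
  | channelId
  | tokenBinding
  | serverEndpoint
  | serverCert
  | exporterLabel
  | exporterContext
  | masterSecret
  | handshakeSecret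
  | clientWriteKey
  | serverWriteKey
  | clientHandshakeKey
  | serverHandshakeKey
  | clientFinished
  | serverFinished
  | certificateVerify
  deriving DecidableEq

/-- Exponents of the Diffie-Hellman group: the free abelian group, written additively, on a
countable set of random exponents.  The sum of two exponents stands for their product. -/
abbrev Expt := ℕ →₀ ℤ

/-- The basic (random) exponent with index `i`. -/
noncomputable def rndx (i : ℕ) : Expt := Finsupp.single i 1

/-- Asymmetric key pairs: the long-term pair of a named principal, or a free-standing pair. -/
inductive KeyPair
  | ofName (a : ℕ)
  | free (i : ℕ)
  deriving DecidableEq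

/-- The Dolev-Yao message algebra.  Atoms come in disjoint sorts.  `dh e` is the group element
`g ^ e`, and `enc m k` is `m` encrypted under `k`, or signed when `k` is a private key. -/
inductive Msg
  | tag (t : Tag)
  | name (a : ℕ)
  | text (i : ℕ)
  | random32 (i : ℕ)
  | random48 (i : ℕ)
  | pub (k : KeyPair)
  | priv (k : KeyPair)
  | expt (e : Expt)
  | dh (e : Expt)
  | pair (m₁ m₂ : Msg)
  | enc (m k : Msg)
  | hash (m : Msg)

namespace Msg

/-- The public key of a named principal. -/
def pubk (a : ℕ) : Msg := pub (.ofName a)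

/-- The private key of a named principal. -/
def privk (a : ℕ) : Msg := priv (.ofName a)

/-- The key that undoes an encryption: the other half of an asymmetric pair; every other message,
used as a key, is symmetric. -/
def inv : Msg → Msg
  | pub k => priv k
  | priv k => pub k
  | m => m

/-- Right-nested concatenation `m, l₀, l₁, …`. -/
def cat : Msg → List Msg → Msg
  | m, [] => m
  | m, m' :: l => pair m (cat m' l)

/-- `t.CarriedBy m`: `t` is `m`, or is carried by a component of a pair or by the plaintext of an
encryption.  Keys, hashed messages and exponents of group elements are not carried. -/
def CarriedBy (t : Msg) : Msg → Prop
  | pair m₁ m₂ => t = pair m₁ m₂ ∨ CarriedBy t m₁ ∨ CarriedBy t m₂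
  | enc m k => t = enc m k ∨ CarriedBy t m
  | m => t = m

/-- The random exponent with index `i` appears in the message, carried or not. -/
def HasRndx (i : ℕ) : Msg → Prop
  | expt e => e i ≠ 0
  | dh e => e i ≠ 0
  | pair m₁ m₂ => HasRndx i m₁ ∨ HasRndx i m₂
  | enc m k => HasRndx i m ∨ HasRndx i k
  | hash m => HasRndx i m
  | _ => False

end Msg

/-- A transmission or a reception of a message. -/
inductive Event
  | send (m : Msg)
  | recv (m : Msg)

/-- The message of an event. -/
def Event.msg : Event → Msg
  | .send m => m
  | .recv m => m

/-! ## Protocol models -/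

/-- The three TLS handshakes. -/
inductive TLS
  | tls12RSA
  | tls12DH
  | tls13
  deriving DecidableEq

/-- The two key exchanges of TLS 1.2. -/
inductive KeyExchange
  | rsa
  | dh
  deriving DecidableEq

/-- The UAF models.  The four standard UAF bindings exist over TLS 1.2 only (with either key
exchange), the exporter binding over TLS 1.3 only, and the unbound model over all of them. -/
inductive Model
  | noBinding (v : TLS)
  | tokenBinding (k : KeyExchange)
  | channelId (k : KeyExchange)
  | endpoint (k : KeyExchange)
  | serverCert (k : KeyExchange)
  | exporterTLS13
  deriving DecidableEq

/-- TLS 1.2 with the given key exchange. -/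
def KeyExchange.tls : KeyExchange → TLS
  | .rsa => .tls12RSA
  | .dh => .tls12DH

/-- The TLS handshake of a model. -/
def Model.tls : Model → TLS
  | .noBinding v => v
  | .tokenBinding k => k.tls
  | .channelId k => k.tls
  | .endpoint k => k.tls
  | .serverCert k => k.tls
  | .exporterTLS13 => .tls13

/-- The four protocol roles. -/
inductive Role
  | clientReg
  | serverReg
  | clientAuth
  | serverAuth
  deriving DecidableEq

/-- The two client roles. -/
def Role.IsClient : Role → Prop
  | .clientReg => True
  | .clientAuth => True
  | _ => False

/-- The two server roles. -/
def Role.IsServer : Role → Prop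
  | .serverReg => True
  | .serverAuth => True
  | _ => False

/-- Two roles are complementary if they sit at opposite ends of the TLS handshake. -/
def Role.Complementary (r r' : Role) : Prop :=
  (r.IsClient ∧ r'.IsServer) ∨ (r.IsServer ∧ r'.IsClient)

/-- The values of the role variables that determine the messages of a run. -/
structure Vars where
  /-- name of the server -/
  server : ℕ
  /-- name of the certificate authority -/
  ca : ℕ
  /-- name that owns the client's channel-binding key pair -/
  client : ℕ
  /-- account name (registration) -/
  username : ℕ
  /-- application identifier, a name -/
  appid : ℕ
  /-- name (aaid) of the authenticator, which also owns the attestation key (registration) -/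
  aaid : ℕ
  /-- the authenticator's authentication key pair -/
  authk : KeyPair
  /-- the server's challenge -/
  challenge : ℕ
  /-- the authenticator's nonce (authentication) -/
  n : ℕ
  /-- client random -/
  cr : ℕ
  /-- server random -/
  sr : ℕ
  /-- premaster secret (RSA key exchange) -/
  pms : ℕ
  /-- client exponent (DH key exchange) -/
  x : Expt
  /-- server exponent (DH key exchange) -/
  y : Expt

section Messages

open Msg

/-- The certificate of `server`, issued by `ca`. -/
def certificate (server ca : ℕ) : Msg :=
  enc (cat (name server) [pubk server, name ca]) (privk ca)

/-- The client's channel-binding public key, together with its self-signature. -/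
def bindingKey (v : Vars) : Msg :=
  cat (pubk v.client) [enc (pubk v.client) (privk v.client)]

/-- The extension of the client hello: for token binding and channel ID the client shares its
binding key with the server there. -/
def helloExtension (M : Model) (v : Vars) : Msg :=
  match M with
  | .tokenBinding _ => bindingKey v
  | .channelId _ => bindingKey v
  | _ => tag .emptyExtension

/-! ### TLS 1.2 -/

/-- The value on which the key schedule of TLS 1.2 is based: the premaster secret, or the DH
shared secret `g ^ (x y)`. -/
noncomputable def TLS12.secret (k : KeyExchange) (v : Vars) : Msg :=
  match k with
  | .rsa => random48 v.pms
  | .dh => dh (v.x + v.y)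

/-- The TLS 1.2 master secret. -/
noncomputable def TLS12.master (k : KeyExchange) (v : Vars) : Msg :=
  hash (cat (TLS12.secret k v) [tag .masterSecret, random32 v.cr, random32 v.sr])

/-- The TLS 1.2 write key with the given label. -/
noncomputable def TLS12.writeKey (k : KeyExchange) (v : Vars) (label : Tag) : Msg :=
  hash (cat (TLS12.master k v) [tag label, random32 v.cr, random32 v.sr])

/-- ClientHello. -/
def TLS12.clientHello (M : Model) (v : Vars) : Msg :=
  cat (random32 v.cr) [helloExtension M v]

/-- ServerHello and Certificate, followed, for DH, by the signed server key exchange. -/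
def TLS12.serverHello (k : KeyExchange) (v : Vars) : Msg :=
  match k with
  | .rsa => cat (random32 v.sr) [certificate v.server v.ca]
  | .dh => cat (random32 v.sr) [certificate v.server v.ca, dh v.y,
      enc (cat (random32 v.cr) [random32 v.sr, dh v.y]) (privk v.server)]

/-- ClientKeyExchange. -/
def TLS12.clientKeyExchange (k : KeyExchange) (v : Vars) : Msg :=
  match k with
  | .rsa => enc (random48 v.pms) (pubk v.server)
  | .dh => dh v.x

/-- The content of the client's Finished message. -/
noncomputable def TLS12.clientFinished (M : Model) (k : KeyExchange) (v : Vars) : Msg :=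
  hash (cat (TLS12.master k v) [tag .clientFinished,
    hash (cat (TLS12.clientHello M v) [TLS12.serverHello k v, TLS12.clientKeyExchange k v])])

/-- The content of the server's Finished message. -/
noncomputable def TLS12.serverFinished (M : Model) (k : KeyExchange) (v : Vars) : Msg :=
  hash (cat (TLS12.master k v) [tag .serverFinished,
    hash (cat (TLS12.clientHello M v) [TLS12.serverHello k v, TLS12.clientKeyExchange k v,
      TLS12.clientFinished M k v])])

/-! ### TLS 1.3 -/

/-- ClientHello with the client's key share. -/
def TLS13.clientHello (M : Model) (v : Vars) : Msg :=
  cat (random32 v.cr) [dh v.x, helloExtension M v]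

/-- ServerHello with the server's key share. -/
def TLS13.serverHello (v : Vars) : Msg :=
  cat (random32 v.sr) [dh v.y]

/-- The handshake secret, derived from `g ^ (x y)`. -/
noncomputable def TLS13.handshakeSecret (v : Vars) : Msg :=
  hash (cat (dh (v.x + v.y)) [tag .handshakeSecret])

/-- The master secret. -/
noncomputable def TLS13.master (v : Vars) : Msg :=
  hash (cat (TLS13.handshakeSecret v) [tag .masterSecret])

/-- The handshake traffic key with the given label. -/
noncomputable def TLS13.handshakeKey (M : Model) (v : Vars) (label : Tag) : Msg :=
  hash (cat (TLS13.handshakeSecret v) [tag label,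
    hash (cat (TLS13.clientHello M v) [TLS13.serverHello v])])

/-- The server's signature (CertificateVerify) on the transcript so far. -/
def TLS13.certificateVerify (M : Model) (v : Vars) : Msg :=
  enc (cat (tag .certificateVerify)
    [hash (cat (TLS13.clientHello M v) [TLS13.serverHello v, certificate v.server v.ca])])
    (privk v.server)

/-- The content of the server's Finished message. -/
noncomputable def TLS13.serverFinished (M : Model) (v : Vars) : Msg :=
  hash (cat (TLS13.handshakeSecret v) [tag .serverFinished,
    hash (cat (TLS13.clientHello M v) [TLS13.serverHello v, certificate v.server v.ca,
      TLS13.certificateVerify M v])])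

/-- The hash of the transcript up to the server's Finished message. -/
noncomputable def TLS13.transcript (M : Model) (v : Vars) : Msg :=
  hash (cat (TLS13.clientHello M v) [TLS13.serverHello v, certificate v.server v.ca,
    TLS13.certificateVerify M v, TLS13.serverFinished M v])

/-- The content of the client's Finished message. -/
noncomputable def TLS13.clientFinished (M : Model) (v : Vars) : Msg :=
  hash (cat (TLS13.handshakeSecret v) [tag .clientFinished, TLS13.transcript M v])

/-- The application traffic (write) key with the given label. -/
noncomputable def TLS13.writeKey (M : Model) (v : Vars) (label : Tag) : Msg :=
  hash (cat (TLS13.master v) [tag label, TLS13.transcript M v])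

/-! ### Handshakes and UAF messages -/

/-- One step of a two-party protocol, described from the client's side: `true` marks a message
from the client to the server, `false` a message from the server to the client. -/
abbrev Step := Bool × Msg

/-- The TLS 1.2 handshake. -/
noncomputable def TLS12.handshake (M : Model) (k : KeyExchange) (v : Vars) : List Step :=
  [(true, TLS12.clientHello M v),
   (false, TLS12.serverHello k v),
   (true, cat (TLS12.clientKeyExchange k v)
      [enc (TLS12.clientFinished M k v) (TLS12.writeKey k v .clientWriteKey)]),
   (false, enc (TLS12.serverFinished M k v) (TLS12.writeKey k v .serverWriteKey))]

/-- The TLS 1.3 handshake. -/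
noncomputable def TLS13.handshake (M : Model) (v : Vars) : List Step :=
  [(true, TLS13.clientHello M v),
   (false, cat (TLS13.serverHello v)
      [enc (cat (certificate v.server v.ca)
          [TLS13.certificateVerify M v, TLS13.serverFinished M v])
        (TLS13.handshakeKey M v .serverHandshakeKey)]),
   (true, enc (TLS13.clientFinished M v) (TLS13.handshakeKey M v .clientHandshakeKey))]

/-- The handshake of a model. -/
noncomputable def handshake (M : Model) (v : Vars) : List Step :=
  match M.tls with
  | .tls12RSA => TLS12.handshake M .rsa v
  | .tls12DH => TLS12.handshake M .dh v
  | .tls13 => TLS13.handshake M v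

/-- The write key of a model: `cwk` for the label `clientWriteKey`, `swk` for
`serverWriteKey`. -/
noncomputable def writeKey (M : Model) (v : Vars) (label : Tag) : Msg :=
  match M.tls with
  | .tls12RSA => TLS12.writeKey .rsa v label
  | .tls12DH => TLS12.writeKey .dh v label
  | .tls13 => TLS13.writeKey M v label

/-- The channel binding data of a model. -/
noncomputable def tlsData (M : Model) (v : Vars) : Msg :=
  match M with
  | .noBinding _ => tag .unbound
  | .tokenBinding _ => hash (cat (tag .tokenBinding) [text v.challenge, bindingKey v])
  | .channelId _ => hash (cat (tag .channelId)
      [text v.challenge, pubk v.client, enc (pubk v.client) (privk v.client)])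
  | .endpoint _ => hash (cat (tag .serverEndpoint)
      [text v.challenge, hash (certificate v.server v.ca)])
  | .serverCert _ => hash (cat (tag .serverCert)
      [text v.challenge, certificate v.server v.ca])
  | .exporterTLS13 => hash (cat (TLS13.master v)
      [tag .exporterLabel, random32 v.cr, random32 v.sr, tag .exporterContext])

/-- The final challenge `fc`. -/
noncomputable def finalChallenge (M : Model) (v : Vars) : Msg :=
  hash (cat (name v.appid) [text v.challenge, tlsData M v])

/-- The registration messages. -/
noncomputable def registration (M : Model) (v : Vars) : List Step :=
  [(false, enc (cat (name v.username) [name v.appid, text v.challenge])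
      (writeKey M v .serverWriteKey)),
   (true, enc (cat (hash (cat (priv v.authk) [name v.username]))
        [name v.aaid, pub v.authk, finalChallenge M v,
         enc (cat (name v.aaid) [finalChallenge M v, pub v.authk]) (privk v.aaid)])
      (writeKey M v .clientWriteKey))]

/-- The authentication messages. -/
noncomputable def authentication (M : Model) (v : Vars) : List Step :=
  [(false, enc (cat (name v.appid) [text v.challenge]) (writeKey M v .serverWriteKey)),
   (true, enc (cat (finalChallenge M v)
        [text v.n, enc (cat (finalChallenge M v) [text v.n]) (priv v.authk)])
      (writeKey M v .clientWriteKey))]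

end Messages

/-- The full message sequence of a role: a TLS handshake followed by the UAF exchange. -/
noncomputable def Role.steps (M : Model) (v : Vars) : Role → List Step
  | .clientReg => handshake M v ++ registration M v
  | .serverReg => handshake M v ++ registration M v
  | .clientAuth => handshake M v ++ authentication M v
  | .serverAuth => handshake M v ++ authentication M v

/-- A client's view of a step. -/
def Step.clientEvent : Step → Event
  | (true, m) => .send m
  | (false, m) => .recv m

/-- A server's view of a step. -/
def Step.serverEvent : Step → Event
  | (true, m) => .recv m
  | (false, m) => .send m

/-- The sequence of events of a role. -/
noncomputable def Role.trace (M : Model) (v : Vars) (r : Role) : List Event :=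
  match r with
  | .clientReg => (r.steps M v).map Step.clientEvent
  | .clientAuth => (r.steps M v).map Step.clientEvent
  | .serverReg => (r.steps M v).map Step.serverEvent
  | .serverAuth => (r.steps M v).map Step.serverEvent

/-- The height of a fully executing strand of a role. -/
def Role.height (M : Model) (_ : Role) : ℕ :=
  match M.tls with
  | .tls12RSA => 6
  | .tls12DH => 6
  | .tls13 => 5

theorem Role.length_trace (M : Model) (v : Vars) (r : Role) :
    (r.trace M v).length = r.height M := by
  cases r <;> cases h : M.tls <;>
    simp [Role.trace, Role.steps, Role.height, handshake, registration, authentication, h,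
      TLS12.handshake, TLS13.handshake]

/-! ## Strand spaces -/

/-- An instance of a role.  A principal's own exponent is a random exponent (with index `own`),
whereas the exponent of the peer, of which only the public value is seen, is arbitrary. -/
structure RoleInstance where
  role : Role
  server : ℕ
  ca : ℕ
  client : ℕ
  username : ℕ
  appid : ℕ
  aaid : ℕ
  authk : KeyPair
  challenge : ℕ
  n : ℕ
  cr : ℕ
  sr : ℕ
  pms : ℕ
  own : ℕ
  peer : Expt

namespace RoleInstance

/-- The client's exponent, as seen by this instance. -/
noncomputable def x (p : RoleInstance) : Expt :=
  match p.role with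
  | .clientReg => rndx p.own
  | .clientAuth => rndx p.own
  | .serverReg => p.peer
  | .serverAuth => p.peer

/-- The server's exponent, as seen by this instance. -/
noncomputable def y (p : RoleInstance) : Expt :=
  match p.role with
  | .clientReg => p.peer
  | .clientAuth => p.peer
  | .serverReg => rndx p.own
  | .serverAuth => rndx p.own

/-- The values of the role variables of an instance. -/
noncomputable def vars (p : RoleInstance) : Vars where
  server := p.server
  ca := p.ca
  client := p.client
  username := p.username
  appid := p.appid
  aaid := p.aaid
  authk := p.authk
  challenge := p.challenge
  n := p.n
  cr := p.cr
  sr := p.sr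
  pms := p.pms
  x := p.x
  y := p.y

/-- The sequence of events of an instance. -/
noncomputable def trace (M : Model) (p : RoleInstance) : List Event := p.role.trace M p.vars

end RoleInstance

/-- The actions of the Dolev-Yao penetrator.  A sent message may be received any number of
times, so that no duplication is needed. -/
inductive Penetrator
  | tag (t : Tag)
  | name (a : ℕ)
  | text (i : ℕ)
  | random32 (i : ℕ)
  | random48 (i : ℕ)
  | pub (k : KeyPair)
  | priv (k : KeyPair)
  | generator
  | one
  | rndx (i : ℕ)
  | mul (e f : Expt)
  | recip (e : Expt)
  | exp (e f : Expt)
  | concat (m₁ m₂ : Msg)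
  | separate (m₁ m₂ : Msg)
  | encrypt (m k : Msg)
  | decrypt (m k : Msg)
  | hash (m : Msg)

/-- The sequence of events of a penetrator action. -/
noncomputable def Penetrator.trace : Penetrator → List Event
  | .tag t => [.send (.tag t)]
  | .name a => [.send (.name a)]
  | .text i => [.send (.text i)]
  | .random32 i => [.send (.random32 i)]
  | .random48 i => [.send (.random48 i)]
  | .pub k => [.send (.pub k)]
  | .priv k => [.send (.priv k)]
  | .generator => [.send (.dh 0)]
  | .one => [.send (.expt 0)]
  | .rndx i => [.send (.expt (UAF.rndx i))]
  | .mul e f => [.recv (.expt e), .recv (.expt f), .send (.expt (e + f))]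
  | .recip e => [.recv (.expt e), .send (.expt (-e))]
  | .exp e f => [.recv (.dh e), .recv (.expt f), .send (.dh (e + f))]
  | .concat m₁ m₂ => [.recv m₁, .recv m₂, .send (.pair m₁ m₂)]
  | .separate m₁ m₂ => [.recv (.pair m₁ m₂), .send m₁, .send m₂]
  | .encrypt m k => [.recv m, .recv k, .send (.enc m k)]
  | .decrypt m k => [.recv (.enc m k), .recv k.inv, .send m]
  | .hash m => [.recv m, .send (.hash m)]

/-- Who executes a strand: an honest protocol participant, a certificate authority that issues,
upon request, the certificate of any named entity, or the penetrator. -/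
inductive Actor
  | participant (p : RoleInstance)
  | certificateAuthority (ca subject : ℕ)
  | penetrator (a : Penetrator)

/-- The strands of the strand space.  The identifier `uid` provides unboundedly many strands with
the same actor. -/
structure Strand where
  actor : Actor
  uid : ℕ

/-- The sequence of events of a strand. -/
noncomputable def Strand.trace (M : Model) (s : Strand) : List Event :=
  match s.actor with
  | .participant p => p.trace M
  | .certificateAuthority ca subject =>
      [.recv (Msg.cat (.name subject) [.name ca]), .send (certificate subject ca)]
  | .penetrator a => a.trace

/-- A node is a position on a strand. -/
structure Node where
  strand : Strand
  index : ℕ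

/-- The event at a node of the strand space. -/
noncomputable def Node.event? (M : Model) (n : Node) : Option Event :=
  (n.strand.trace M)[n.index]?

/-- `t` originates at `n`: the node `n` transmits a message that carries `t`, and no earlier
message on the same strand carries `t`. -/
def Node.Originates (M : Model) (n : Node) (t : Msg) : Prop :=
  (∃ m, n.event? M = some (.send m) ∧ t.CarriedBy m) ∧
    ∀ k < n.index, ∀ e, Node.event? M ⟨n.strand, k⟩ = some e → ¬ t.CarriedBy e.msg

/-- The random exponent `i` is generated at `n`: the node `n` transmits a message in which it
appears, and it appears in no earlier message on the same strand. -/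
def Node.Generates (M : Model) (n : Node) (i : ℕ) : Prop :=
  (∃ m, n.event? M = some (.send m) ∧ m.HasRndx i) ∧
    ∀ k < n.index, ∀ e, Node.event? M ⟨n.strand, k⟩ = some e → ¬ e.msg.HasRndx i

/-- Bundles of the strand space of a model: finitely many initial segments of strands, such that
every reception is matched with exactly one transmission of the same message, and the causal
relation formed by strand succession and message delivery is acyclic. -/
structure Bundle (M : Model) where
  /-- the number of nodes of each strand that belong to the bundle -/
  height : Strand → ℕ
  height_le : ∀ s, height s ≤ (s.trace M).length
  finite : {s | 0 < height s}.Finite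
  /-- message delivery -/
  deliver : Node → Node → Prop
  deliver_spec : ∀ n n', deliver n n' →
    n.index < height n.strand ∧ n'.index < height n'.strand ∧
      ∃ m, n.event? M = some (.send m) ∧ n'.event? M = some (.recv m)
  existsUnique_sender : ∀ n', n'.index < height n'.strand →
    ∀ m, n'.event? M = some (.recv m) → ∃! n, deliver n n'
  acyclic : ∀ n, ¬ Relation.TransGen
    (fun a b => (a.strand = b.strand ∧ b.index = a.index + 1 ∧ b.index < height b.strand) ∨
      deliver a b) n n

namespace Bundle

variable {M : Model}

/-- The node belongs to the bundle. -/
def HasNode (B : Bundle M) (n : Node) : Prop := n.index < B.height n.strand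

/-- The strand takes part in the bundle. -/
def HasStrand (B : Bundle M) (s : Strand) : Prop := 0 < B.height s

/-- `t` is non-originating: it is carried by no message of the bundle. -/
def NonOriginating (B : Bundle M) (t : Msg) : Prop :=
  ∀ n, B.HasNode n → ∀ e, n.event? M = some e → ¬ t.CarriedBy e.msg

/-- `t` originates on the strand `s`, and at exactly one node of the bundle. -/
def UniquelyOriginates (B : Bundle M) (s : Strand) (t : Msg) : Prop :=
  ∃ n, n.strand = s ∧ B.HasNode n ∧ n.Originates M t ∧
    ∀ n', B.HasNode n' → n'.Originates M t → n' = n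

/-- The random exponent `i` is generated on `s`, and at exactly one node of the bundle. -/
def UniquelyGenerates (B : Bundle M) (s : Strand) (i : ℕ) : Prop :=
  ∃ n, n.strand = s ∧ B.HasNode n ∧ n.Generates M i ∧
    ∀ n', B.HasNode n' → n'.Generates M i → n' = n

/-- The freshness that the server roles declare for themselves: with a DH key exchange, a server
strand that has used its exponent in a transmission generates that exponent uniquely. -/
def ServersFresh (B : Bundle M) : Prop :=
  M.tls ≠ .tls12RSA → ∀ (s : Strand) (p : RoleInstance), s.actor = .participant p →
    p.role.IsServer →
    (∃ k m, B.HasNode ⟨s, k⟩ ∧ Node.event? M ⟨s, k⟩ = some (.send m) ∧ m.HasRndx p.own) →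
    B.UniquelyGenerates s p.own

end Bundle

/-! ## Session contexts, origination assumptions and goals -/

/-- A session context: the facts that must hold for a pair of role instances. -/
abbrev SessionContext := RoleInstance → RoleInstance → Prop

/-- Origination assumptions for an instance executed by a strand of a bundle. -/
abbrev OriginationAssumptions (M : Model) := Bundle M → Strand → RoleInstance → Prop

/-- The TLS session context of a model. -/
def tlsContext (M : Model) : SessionContext := fun p q =>
  p.server = q.server ∧ p.ca = q.ca ∧ p.cr = q.cr ∧ p.sr = q.sr ∧
    (M.tls = .tls12RSA → p.pms = q.pms) ∧
    (M.tls ≠ .tls12RSA → p.x = q.x ∧ p.y = q.y)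

/-- The UAF authentication session context. -/
def authContext (M : Model) : SessionContext := fun p q =>
  tlsContext M p q ∧ p.challenge = q.challenge ∧ p.server = q.server ∧ p.appid = q.appid

/-- The client assumptions: the private keys of the certificate authority, of the server and of
the authenticator are non-originating, and the client freshly creates its TLS nonce and its
premaster secret or DH exponent. -/
def clientAssumptions (M : Model) : OriginationAssumptions M := fun B s p =>
  B.NonOriginating (.privk p.ca) ∧ B.NonOriginating (.privk p.server) ∧
    B.NonOriginating (.priv p.authk) ∧
    B.UniquelyOriginates s (.random32 p.cr) ∧
    (M.tls = .tls12RSA → B.UniquelyOriginates s (.random48 p.pms)) ∧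
    (M.tls ≠ .tls12RSA → B.UniquelyGenerates s p.own)

/-- Successful completion: whenever a strand of role `Ra` reaches height `i` under its
origination assumptions, there is a complementary strand of role `Rb` of height at least `j`
in the bundle that satisfies the session context with it. -/
def Succ (M : Model) (Ra Rb : Role) (Ctx : SessionContext) (Orig : OriginationAssumptions M)
    (i j : ℕ) : Prop :=
  ∀ B : Bundle M, B.ServersFresh → ∀ (s : Strand) (p : RoleInstance),
    s.actor = .participant p → p.role = Ra → B.HasStrand s → i ≤ B.height s → Orig B s p →
    ∃ (s' : Strand) (q : RoleInstance), s'.actor = .participant q ∧ q.role = Rb ∧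
      Ra.Complementary Rb ∧ B.HasStrand s' ∧ j ≤ B.height s' ∧ Ctx p q

/-- Unique completion: the role of the complementary strand is determined. -/
def Uniq (M : Model) (Ra : Role) (Ctx : SessionContext) (Orig : OriginationAssumptions M)
    (i j : ℕ) : Prop :=
  ∀ Rb Rc : Role, Succ M Ra Rb Ctx Orig i j ∧ Succ M Ra Rc Ctx Orig i j → Rb = Rc

/-- Session context agreement with a given height `j` of the complementary strand. -/
def SessionContextAgreementAt (M : Model) (Ra Rb : Role) (Ctx : SessionContext)
    (Orig : OriginationAssumptions M) (j : ℕ) : Prop :=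
  j ≤ Rb.height M ∧ Succ M Ra Rb Ctx Orig (Ra.height M) j ∧ Uniq M Ra Ctx Orig (Ra.height M) j

/-- Session context agreement (the security goal). -/
def SessionContextAgreement (M : Model) (Ra Rb : Role) (Ctx : SessionContext)
    (Orig : OriginationAssumptions M) : Prop :=
  ∃ j, SessionContextAgreementAt M Ra Rb Ctx Orig j

/-- The server random of a client's session is fresh: it originates uniquely, and not on the
client strand itself. -/
def freshServerRandom (M : Model) : OriginationAssumptions M := fun B s p =>
  ∃ t, t ≠ s ∧ B.UniquelyOriginates t (.random32 p.sr)

/-- Injectivity at the level of strands: in every bundle, a strand `s` of role `Ra` that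
completes under its origination assumptions has a partner `s'` of role `Rb` of height at least
`j` that satisfies the session context with it, no other strand complementary to `s` of height at
least `j`, whatever its role, does so, and no strand other than `s` complementary to `s'`
satisfies the session context with `s'`. -/
def UniquePartner (M : Model) (Ra Rb : Role) (Ctx : SessionContext)
    (Orig : OriginationAssumptions M) (j : ℕ) : Prop :=
  ∀ B : Bundle M, B.ServersFresh → ∀ (s : Strand) (p : RoleInstance),
    s.actor = .participant p → p.role = Ra → Ra.height M ≤ B.height s → Orig B s p →
    ∃ (s' : Strand) (q : RoleInstance), s'.actor = .participant q ∧ q.role = Rb ∧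
      Ra.Complementary Rb ∧ B.HasStrand s' ∧ j ≤ B.height s' ∧ Ctx p q ∧
      (∀ (t : Strand) (r : RoleInstance), t.actor = .participant r → Ra.Complementary r.role →
        B.HasStrand t → j ≤ B.height t → Ctx p r → t = s') ∧
      (∀ (t : Strand) (r : RoleInstance), t.actor = .participant r → Rb.Complementary r.role →
        B.HasStrand t → Ctx r q → t = s)

end UAF

/-! The agreement is an authentication test on the challenge. The client has received the challenge
encrypted under its server write key. If that key is secret, the ciphertext was first sent by a
regular strand (`exists_regular_sends`). By its shape only a server-auth strand can have sent it, as
its last transmission (`Sends.challenge`). Hence challenge, appid and server write key coincide, and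
the server lacks at most its final reception.

The rest of the context is read off by injectivity of the free message algebra. In TLS 1.3 the write
key hashes the whole transcript, so the key alone suffices. In TLS 1.2 it fixes only the shared
secret and the two randoms. There the server has also received a client Finished message under the
equally secret client write key. This comes from a client strand with the same client random, which
must be the given one, since that random originates uniquely. The transcript hash in Finished
settles everything else. This is `exists_partner`.

Secrecy of the keys (`nonOriginating_writeKey`) is climbed along the key schedule: regular strands
never send a hash of key material in the open, and the penetrator must possess the preimage
(`NonOriginating.hash`). At the bottom lies the shared secret. A premaster secret occurs only
encrypted under the server's public key (`forall_shielded`). For DH, the server's signature shows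
that the peer exponent belongs to a server strand (`exists_server_exponent`), so it is uniquely
generated. A degree count in the two fresh exponents then shows that `g ^ (x y)` never appears
(`nonOriginating_dh`).

The partner role is determined because an undisturbed session contains only one client-auth and one
server-auth strand (`Succ.eq_serverAuth`). Uniqueness of the partner strands follows from freshness
of the client random on one side, and of the server random or the server's exponent on the other. -/

namespace UAF

variable {M : Model}

/-! ### The carrying relation -/

namespace Msg

@[simp] theorem carriedBy_tag {t : Msg} {a : Tag} : t.CarriedBy (tag a) ↔ t = tag a := Iff.rfl
@[simp] theorem carriedBy_name {t : Msg} {a : ℕ} : t.CarriedBy (name a) ↔ t = name a := Iff.rfl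
@[simp] theorem carriedBy_text {t : Msg} {a : ℕ} : t.CarriedBy (text a) ↔ t = text a := Iff.rfl
@[simp] theorem carriedBy_random32 {t : Msg} {a : ℕ} :
    t.CarriedBy (random32 a) ↔ t = random32 a := Iff.rfl
@[simp] theorem carriedBy_random48 {t : Msg} {a : ℕ} :
    t.CarriedBy (random48 a) ↔ t = random48 a := Iff.rfl
@[simp] theorem carriedBy_pub {t : Msg} {a : KeyPair} : t.CarriedBy (pub a) ↔ t = pub a := Iff.rfl
@[simp] theorem carriedBy_priv {t : Msg} {a : KeyPair} :
    t.CarriedBy (priv a) ↔ t = priv a := Iff.rfl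
@[simp] theorem carriedBy_expt {t : Msg} {a : Expt} : t.CarriedBy (expt a) ↔ t = expt a := Iff.rfl
@[simp] theorem carriedBy_dh {t : Msg} {a : Expt} : t.CarriedBy (dh a) ↔ t = dh a := Iff.rfl
@[simp] theorem carriedBy_hash {t m : Msg} : t.CarriedBy (hash m) ↔ t = hash m := Iff.rfl
@[simp] theorem carriedBy_pair {t m₁ m₂ : Msg} :
    t.CarriedBy (pair m₁ m₂) ↔ t = pair m₁ m₂ ∨ t.CarriedBy m₁ ∨ t.CarriedBy m₂ := Iff.rfl
@[simp] theorem carriedBy_enc {t m k : Msg} :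
    t.CarriedBy (enc m k) ↔ t = enc m k ∨ t.CarriedBy m := Iff.rfl

theorem carriedBy_refl (m : Msg) : m.CarriedBy m := by
  cases m <;> simp

theorem CarriedBy.trans {a b c : Msg} (hab : a.CarriedBy b) (hbc : b.CarriedBy c) :
    a.CarriedBy c := by
  induction c with
  | pair m₁ m₂ h₁ h₂ =>
    rcases hbc with rfl | h | h
    · exact hab
    · exact .inr (.inl (h₁ h))
    · exact .inr (.inr (h₂ h))
  | enc m k h₁ _ =>
    rcases hbc with rfl | h
    · exact hab
    · exact .inr (h₁ h)
  | _ => cases hbc; exact hab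

@[simp] theorem cat_nil (m : Msg) : cat m [] = m := rfl
@[simp] theorem cat_cons (m m' : Msg) (l : List Msg) : cat m (m' :: l) = pair m (cat m' l) := rfl

end Msg

open Msg

/-! ### Induction along the causal order of a bundle -/

namespace Bundle

variable (B : Bundle M)

/-- Immediate causal precedence in a bundle. -/
def Precedes (a b : Node) : Prop :=
  (a.strand = b.strand ∧ b.index = a.index + 1 ∧ b.index < B.height b.strand) ∨ B.deliver a b

theorem finite_nodes : {n | B.HasNode n}.Finite := by
  have h : {n | B.HasNode n} ⊆
      ⋃ s ∈ {s | 0 < B.height s}, (fun k => Node.mk s k) '' Set.Iio (B.height s) := by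
    intro n hn
    simp only [Set.mem_iUnion]
    exact ⟨n.strand, Nat.zero_lt_of_lt hn, n.index, hn, rfl⟩
  exact (B.finite.biUnion fun s _ => (Set.finite_Iio _).image _).subset h

/-- A bundle has finitely many nodes and its precedence relation is acyclic, so the transitive
closure of that relation is well-founded. -/
theorem node_induction {P : Node → Prop}
    (h : ∀ n, B.HasNode n →
      (∀ n', B.HasNode n' → Relation.TransGen B.Precedes n' n → P n') → P n) :
    ∀ n, B.HasNode n → P n := by
  have : Finite {n // B.HasNode n} := B.finite_nodes
  let r : {n // B.HasNode n} → {n // B.HasNode n} → Prop :=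
    fun a b => Relation.TransGen B.Precedes a.1 b.1
  have htr : IsTrans _ r := ⟨fun _ _ _ => Relation.TransGen.trans⟩
  have hir : Std.Irrefl r := ⟨fun a => B.acyclic a.1⟩
  have wf : WellFounded r := Finite.wellFounded_of_trans_of_irrefl r
  intro n hn
  exact wf.induction (C := fun a => P a.1) ⟨n, hn⟩
    fun a ih => h a.1 a.2 fun n' h' hp => ih ⟨n', h'⟩ hp

theorem transGen_precedes {s : Strand} {k l : ℕ} (hkl : k < l) (hl : l < B.height s) :
    Relation.TransGen B.Precedes ⟨s, k⟩ ⟨s, l⟩ := by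
  induction l, hkl using Nat.le_induction with
  | base => exact .single (.inl ⟨rfl, rfl, hl⟩)
  | succ l _ ih => exact .tail (ih (by omega)) (.inl ⟨rfl, rfl, hl⟩)

theorem hasNode_of_lt {s : Strand} {k l : ℕ} (h : B.HasNode ⟨s, l⟩) (hkl : k < l) :
    B.HasNode ⟨s, k⟩ := lt_trans hkl h

/-- A property of messages that every transmission inherits from the earlier messages of its
strand holds for all messages of a bundle. -/
theorem forall_msg {Q : Msg → Prop}
    (h : ∀ s k m, B.HasNode ⟨s, k⟩ → Node.event? M ⟨s, k⟩ = some (.send m) →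
      (∀ l < k, ∀ e, Node.event? M ⟨s, l⟩ = some e → Q e.msg) → Q m) :
    ∀ n, B.HasNode n → ∀ e, n.event? M = some e → Q e.msg := by
  refine B.node_induction fun n hn ih => ?_
  rintro (m | m) he
  · exact h n.strand n.index m hn he fun l hl e =>
      ih ⟨n.strand, l⟩ (lt_trans hl hn) (B.transGen_precedes hl hn) e
  · obtain ⟨n', hd, -⟩ := B.existsUnique_sender n hn m he
    obtain ⟨h', -, m', hs, hr⟩ := B.deliver_spec _ _ hd
    rw [he] at hr
    cases hr
    have := ih n' h' (.single (.inr hd)) _ hs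
    exact this

variable {B}

theorem NonOriginating.mono {a b : Msg} (h : B.NonOriginating a) (hab : a.CarriedBy b) :
    B.NonOriginating b :=
  fun n hn e he hb => h n hn e he (hab.trans hb)

end Bundle

/-! ### What the penetrator can build -/

/-- The strand is not a penetrator strand. -/
def Strand.Regular (s : Strand) : Prop := ∀ a, s.actor ≠ .penetrator a

/-- The strand `s` sends, at a position that belongs to the bundle, the message `m`. -/
def Bundle.Sends (B : Bundle M) (s : Strand) (k : ℕ) (m : Msg) : Prop :=
  B.HasNode ⟨s, k⟩ ∧ Node.event? M ⟨s, k⟩ = some (.send m)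

theorem Strand.event?_penetrator {s : Strand} {a : Penetrator}
    (h : s.actor = .penetrator a) (k : ℕ) : Node.event? M ⟨s, k⟩ = a.trace[k]? := by
  simp [Node.event?, Strand.trace, h]

theorem Strand.event?_participant {s : Strand} {p : RoleInstance}
    (h : s.actor = .participant p) (k : ℕ) : Node.event? M ⟨s, k⟩ = (p.trace M)[k]? := by
  simp [Node.event?, Strand.trace, h]

/-- Induction over the messages of a bundle, with the penetrator's actions listed. -/
theorem Bundle.forall_msg_of_closed (B : Bundle M) {Q : Msg → Prop}
    (regular : ∀ s k m, s.Regular → B.Sends s k m →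
      (∀ l < k, ∀ e, Node.event? M ⟨s, l⟩ = some e → Q e.msg) → Q m)
    (tag : ∀ t, Q (.tag t)) (name : ∀ a, Q (.name a)) (text : ∀ i, Q (.text i))
    (random32 : ∀ i, Q (.random32 i))
    (random48 : ∀ s i, s.actor = .penetrator (.random48 i) → B.HasNode ⟨s, 0⟩ → Q (.random48 i))
    (pub : ∀ k, Q (.pub k)) (priv : ∀ k, Q (.priv k))
    (generator : Q (.dh 0)) (one : Q (.expt 0))
    (rndx : ∀ s i, s.actor = .penetrator (.rndx i) → B.HasNode ⟨s, 0⟩ → Q (.expt (UAF.rndx i)))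
    (mul : ∀ e f, Q (.expt e) → Q (.expt f) → Q (.expt (e + f)))
    (recip : ∀ e, Q (.expt e) → Q (.expt (-e)))
    (exp : ∀ e f, Q (.dh e) → Q (.expt f) → Q (.dh (e + f)))
    (pair : ∀ m₁ m₂, Q m₁ → Q m₂ → Q (.pair m₁ m₂))
    (fst : ∀ m₁ m₂, Q (.pair m₁ m₂) → Q m₁) (snd : ∀ m₁ m₂, Q (.pair m₁ m₂) → Q m₂)
    (enc : ∀ s m k, s.actor = .penetrator (.encrypt m k) → B.HasNode ⟨s, 1⟩ → Q m → Q k →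
      Q (.enc m k))
    (dec : ∀ s m k, s.actor = .penetrator (.decrypt m k) → B.HasNode ⟨s, 1⟩ → Q (.enc m k) →
      Q k.inv → Q m)
    (hash : ∀ s m, s.actor = .penetrator (.hash m) → B.HasNode ⟨s, 0⟩ → Q m → Q (.hash m)) :
    ∀ n, B.HasNode n → ∀ e, n.event? M = some e → Q e.msg := by
  refine B.forall_msg fun s k m hn he ih => ?_
  by_cases hs : s.Regular
  · exact regular s k m hs ⟨hn, he⟩ ih
  · obtain ⟨a, ha⟩ : ∃ a, s.actor = .penetrator a := by
      simpa [Strand.Regular] using hs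
    simp only [Strand.event?_penetrator ha] at he ih
    have h1 : ∀ l < k, B.HasNode ⟨s, l⟩ := fun l hl => B.hasNode_of_lt hn hl
    rcases k with _ | _ | _ | k <;> cases a <;>
      simp only [Penetrator.trace, List.getElem?_cons_zero, List.getElem?_cons_succ,
        List.getElem?_nil, Option.some.injEq, Event.send.injEq, reduceCtorEq] at he <;>
      subst he
    all_goals first
      | exact tag _ | exact name _ | exact text _ | exact random32 _ | exact random48 _ _ ha hn
      | exact pub _ | exact priv _ | exact generator | exact one | exact rndx _ _ ha hn
      | exact mul _ _ (ih 0 (by omega) _ rfl) (ih 1 (by omega) _ rfl)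
      | exact recip _ (ih 0 (by omega) _ rfl)
      | exact exp _ _ (ih 0 (by omega) _ rfl) (ih 1 (by omega) _ rfl)
      | exact pair _ _ (ih 0 (by omega) _ rfl) (ih 1 (by omega) _ rfl)
      | exact fst _ _ (ih 0 (by omega) _ rfl)
      | exact snd _ _ (ih 0 (by omega) _ rfl)
      | exact enc _ _ _ ha (h1 1 (by omega)) (ih 0 (by omega) _ rfl) (ih 1 (by omega) _ rfl)
      | exact dec _ _ _ ha (h1 1 (by omega)) (ih 0 (by omega) _ rfl) (ih 1 (by omega) _ rfl)
      | exact hash _ _ ha (h1 0 (by omega)) (ih 0 (by omega) _ rfl)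

/-- A hash of a secret, and an encryption under a secret key, come from regular strands. -/
theorem Bundle.exists_regular_sends (B : Bundle M) {t c : Msg}
    (htc : t = .hash c ∨ ∃ m, t = .enc m c) (hc : B.NonOriginating c) {n : Node}
    (hn : B.HasNode n) {e : Event} (he : n.event? M = some e) (ht : t.CarriedBy e.msg) :
    ∃ s k m, s.Regular ∧ B.Sends s k m ∧ t.CarriedBy m := by
  by_contra! hno
  refine B.forall_msg_of_closed (Q := fun m => ¬ t.CarriedBy m) (fun s k m hs hm _ => hno s k m hs hm)
    ?_ ?_ ?_ ?_ ?_ ?_ ?_ ?_ ?_ ?_ ?_ ?_ ?_ ?_ ?_ ?_ ?_ ?_ ?_ n hn e he ht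
  -- Encryption (this case) and hashing (`refine_19`) are the only penetrator actions that could
  -- create `t`. Both would first receive `c`, which `hc` forbids.
  case refine_17 =>
    intro s m k ha hb hm hk h
    rcases h with h | h
    · rcases htc with rfl | ⟨m', rfl⟩
      · simp at h
      · cases h
        refine hc _ hb (.recv c) ?_ (carriedBy_refl _)
        rw [Strand.event?_penetrator ha]; rfl
    · exact hm h
  case refine_19 =>
    intro s m ha hb hm h
    rcases htc with rfl | ⟨m', rfl⟩
    · cases h
      refine hc _ hb (.recv c) ?_ (carriedBy_refl _)
      rw [Strand.event?_penetrator ha]; rfl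
    · simp at h
  all_goals rcases htc with rfl | ⟨m', rfl⟩ <;> simp_all

/-! ### Shapes of the messages sent by regular strands -/

theorem handshake_tls12 {k : KeyExchange} (h : M.tls = k.tls) (v : Vars) :
    handshake M v = TLS12.handshake M k v := by
  cases k <;> simp_all [handshake, KeyExchange.tls]

theorem writeKey_tls12 {k : KeyExchange} (h : M.tls = k.tls) (v : Vars) (l : Tag) :
    writeKey M v l = TLS12.writeKey k v l := by
  cases k <;> simp_all [writeKey, KeyExchange.tls]

theorem handshake_tls13 (h : M.tls = .tls13) (v : Vars) :
    handshake M v = TLS13.handshake M v := by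
  simp_all [handshake]

theorem writeKey_tls13 (h : M.tls = .tls13) (v : Vars) (l : Tag) :
    writeKey M v l = TLS13.writeKey M v l := by
  simp_all [writeKey]

theorem Model.tls_cases (M : Model) : (∃ k : KeyExchange, M.tls = k.tls) ∨ M.tls = .tls13 := by
  cases h : M.tls
  · exact .inl ⟨.rsa, rfl⟩
  · exact .inl ⟨.dh, rfl⟩
  · exact .inr rfl

/-- The extension is the only message part that varies with the binding. This lemma lets all models
with the same handshake be treated together. -/
theorem carriedBy_helloExtension {t : Msg} {v : Vars} (h : t.CarriedBy (helloExtension M v)) :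
    t = tag .emptyExtension ∨ t = pubk v.client ∨ t = enc (pubk v.client) (privk v.client) ∨
      t = pair (pubk v.client) (enc (pubk v.client) (privk v.client)) := by
  cases M <;> simp [helloExtension, bindingKey, pubk] at h ⊢ <;> tauto

@[simp] theorem not_hash_carriedBy_helloExtension {m : Msg} {v : Vars} :
    ¬ (hash m).CarriedBy (helloExtension M v) := by
  intro h; simpa [pubk] using carriedBy_helloExtension h

@[simp] theorem not_dh_carriedBy_helloExtension {e : Expt} {v : Vars} :
    ¬ (dh e).CarriedBy (helloExtension M v) := by
  intro h; simpa [pubk] using carriedBy_helloExtension h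

@[simp] theorem not_expt_carriedBy_helloExtension {e : Expt} {v : Vars} :
    ¬ (expt e).CarriedBy (helloExtension M v) := by
  intro h; simpa [pubk] using carriedBy_helloExtension h

@[simp] theorem not_random32_carriedBy_helloExtension {i : ℕ} {v : Vars} :
    ¬ (random32 i).CarriedBy (helloExtension M v) := by
  intro h; simpa [pubk] using carriedBy_helloExtension h

@[simp] theorem not_random48_carriedBy_helloExtension {i : ℕ} {v : Vars} :
    ¬ (random48 i).CarriedBy (helloExtension M v) := by
  intro h; simpa [pubk] using carriedBy_helloExtension h

/-- The extension contains at most the self-signature of a public key, so it is never the source of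
an encryption whose plaintext is a pair or a hash. -/
theorem enc_carriedBy_helloExtension {m k : Msg} {v : Vars}
    (h : (enc m k).CarriedBy (helloExtension M v)) :
    m = pubk v.client ∧ k = privk v.client := by
  simpa [pubk] using carriedBy_helloExtension h

theorem Strand.Regular.cases {s : Strand} (h : s.Regular) :
    (∃ p, s.actor = .participant p) ∨ ∃ ca a, s.actor = .certificateAuthority ca a := by
  cases ha : s.actor with
  | participant p => exact .inl ⟨p, rfl⟩
  | certificateAuthority ca a => exact .inr ⟨ca, a, rfl⟩
  | penetrator a => exact absurd ha (h a)

namespace Bundle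

variable {B : Bundle M} {s : Strand} {k : ℕ} {m : Msg} {p : RoleInstance}

theorem Sends.certificateAuthority (h : B.Sends s k m) {ca a : ℕ}
    (hs : s.actor = .certificateAuthority ca a) : m = certificate a ca := by
  obtain ⟨-, h⟩ := h
  rcases k with _ | _ | k <;> simp [Node.event?, Strand.trace, hs] at h
  exact h.symm

theorem Sends.steps (h : B.Sends s k m) (hs : s.actor = .participant p) :
    (p.role.IsClient ∧ (p.role.steps M p.vars)[k]? = some (true, m)) ∨
      (p.role.IsServer ∧ (p.role.steps M p.vars)[k]? = some (false, m)) := by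
  obtain ⟨-, h⟩ := h
  rw [Strand.event?_participant hs] at h
  have hc : ∀ t : Step, Step.clientEvent t = .send m ↔ t = (true, m) := by
    rintro ⟨_ | _, m'⟩ <;> simp [Step.clientEvent]
  have hv : ∀ t : Step, Step.serverEvent t = .send m ↔ t = (false, m) := by
    rintro ⟨_ | _, m'⟩ <;> simp [Step.serverEvent]
  cases hr : p.role <;>
    simp only [RoleInstance.trace, Role.trace, hr, List.getElem?_map, Option.map_eq_some_iff,
      hc, hv, exists_eq_right] at h <;>
    simp only [Role.IsClient, Role.IsServer, h, true_and, false_and, or_true, true_or]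

/-- The transmissions of the participants over TLS 1.2. -/
theorem Sends.tls12 (h : B.Sends s k m) (hs : s.actor = .participant p) {x : KeyExchange}
    (hM : M.tls = x.tls) :
    (p.role.IsClient ∧
      ((k = 0 ∧ m = TLS12.clientHello M p.vars) ∨
       (k = 2 ∧ m = pair (TLS12.clientKeyExchange x p.vars)
          (enc (TLS12.clientFinished M x p.vars) (TLS12.writeKey x p.vars .clientWriteKey))) ∨
       (p.role = .clientReg ∧ k = 5 ∧
          m = enc (cat (hash (cat (priv p.authk) [name p.username]))
            [name p.aaid, pub p.authk, finalChallenge M p.vars,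
            enc (cat (name p.aaid) [finalChallenge M p.vars, pub p.authk]) (privk p.aaid)])
            (TLS12.writeKey x p.vars .clientWriteKey)) ∨
       (p.role = .clientAuth ∧ k = 5 ∧
          m = enc (cat (finalChallenge M p.vars)
            [text p.n, enc (cat (finalChallenge M p.vars) [text p.n]) (priv p.authk)])
            (TLS12.writeKey x p.vars .clientWriteKey)))) ∨
    (p.role.IsServer ∧
      ((k = 1 ∧ m = TLS12.serverHello x p.vars) ∨
       (k = 3 ∧ m = enc (TLS12.serverFinished M x p.vars)
          (TLS12.writeKey x p.vars .serverWriteKey)) ∨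
       (p.role = .serverReg ∧ k = 4 ∧
          m = enc (cat (name p.username) [name p.appid, text p.challenge])
            (TLS12.writeKey x p.vars .serverWriteKey)) ∨
       (p.role = .serverAuth ∧ k = 4 ∧
          m = enc (cat (name p.appid) [text p.challenge])
            (TLS12.writeKey x p.vars .serverWriteKey)))) := by
  have key := h.steps hs
  cases hr : p.role <;>
    simp only [hr, Role.IsClient, Role.IsServer, Role.steps, handshake_tls12 hM, TLS12.handshake,
      registration, authentication, writeKey_tls12 hM, List.cons_append, List.nil_append,
      true_and, false_and, or_false, false_or, reduceCtorEq] at key ⊢ <;>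
    rcases k with _ | _ | _ | _ | _ | _ | k <;>
    simp only [List.getElem?_cons_zero, List.getElem?_cons_succ, List.getElem?_nil,
      Option.some.injEq, Prod.mk.injEq, reduceCtorEq, true_and, false_and, Bool.false_eq_true,
      or_false, false_or, Nat.reduceAdd, Nat.reduceEqDiff] at key ⊢ <;>
    exact key.symm

/-- The transmissions of the participants over TLS 1.3. -/
theorem Sends.tls13 (h : B.Sends s k m) (hs : s.actor = .participant p)
    (hM : M.tls = .tls13) :
    (p.role.IsClient ∧
      ((k = 0 ∧ m = TLS13.clientHello M p.vars) ∨
       (k = 2 ∧ m = enc (TLS13.clientFinished M p.vars)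
          (TLS13.handshakeKey M p.vars .clientHandshakeKey)) ∨
       (p.role = .clientReg ∧ k = 4 ∧
          m = enc (cat (hash (cat (priv p.authk) [name p.username]))
            [name p.aaid, pub p.authk, finalChallenge M p.vars,
            enc (cat (name p.aaid) [finalChallenge M p.vars, pub p.authk]) (privk p.aaid)])
            (TLS13.writeKey M p.vars .clientWriteKey)) ∨
       (p.role = .clientAuth ∧ k = 4 ∧
          m = enc (cat (finalChallenge M p.vars)
            [text p.n, enc (cat (finalChallenge M p.vars) [text p.n]) (priv p.authk)])
            (TLS13.writeKey M p.vars .clientWriteKey)))) ∨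
    (p.role.IsServer ∧
      ((k = 1 ∧ m = cat (TLS13.serverHello p.vars)
          [enc (cat (certificate p.server p.ca)
            [TLS13.certificateVerify M p.vars, TLS13.serverFinished M p.vars])
            (TLS13.handshakeKey M p.vars .serverHandshakeKey)]) ∨
       (p.role = .serverReg ∧ k = 3 ∧
          m = enc (cat (name p.username) [name p.appid, text p.challenge])
            (TLS13.writeKey M p.vars .serverWriteKey)) ∨
       (p.role = .serverAuth ∧ k = 3 ∧
          m = enc (cat (name p.appid) [text p.challenge])
            (TLS13.writeKey M p.vars .serverWriteKey)))) := by
  have key := h.steps hs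
  cases hr : p.role <;>
    simp only [hr, Role.IsClient, Role.IsServer, Role.steps, handshake_tls13 hM, TLS13.handshake,
      registration, authentication, writeKey_tls13 hM, List.cons_append, List.nil_append,
      true_and, false_and, or_false, false_or, reduceCtorEq] at key ⊢ <;>
    rcases k with _ | _ | _ | _ | _ | k <;>
    simp only [List.getElem?_cons_zero, List.getElem?_cons_succ, List.getElem?_nil,
      Option.some.injEq, Prod.mk.injEq, reduceCtorEq, true_and, false_and, Bool.false_eq_true,
      or_false, false_or, Nat.reduceAdd, Nat.reduceEqDiff] at key ⊢ <;>
    exact key.symm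

end Bundle

/-! ### Key material, and invariants of regular transmissions -/

/-- The contents of the hashes in the key schedules: shared secrets with a context, and derived
secrets with the label of a master secret or a traffic key. -/
def KeyMaterial : Msg → Prop
  | pair (dh _) _ => True
  | pair (random48 _) _ => True
  | pair (.hash _) (tag .masterSecret) => True
  | pair (.hash _) (pair (tag .clientWriteKey) _) => True
  | pair (.hash _) (pair (tag .serverWriteKey) _) => True
  | _ => False

/-- The message shows `random48 i`, if at all, only encrypted under the public key of `a`. -/
def Shielded (i a : ℕ) : Msg → Prop
  | random48 j => j ≠ i
  | pair m₁ m₂ => Shielded i a m₁ ∧ Shielded i a m₂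
  | enc m k => (m = random48 i ∧ k = pubk a) ∨ Shielded i a m
  | _ => True

theorem shielded_of_not_carriedBy {i a : ℕ} {m : Msg} (h : ¬ (random48 i).CarriedBy m) :
    Shielded i a m := by
  induction m with
  | pair m₁ m₂ h₁ h₂ =>
    simp only [carriedBy_pair, reduceCtorEq, false_or, not_or] at h
    exact ⟨h₁ h.1, h₂ h.2⟩
  | enc m k h₁ _ =>
    simp only [carriedBy_enc, reduceCtorEq, false_or] at h
    exact .inr (h₁ h)
  | random48 j => simpa [Shielded, eq_comm] using h
  | _ => trivial

/-- Shielding descends to carried parts with one exception: removing the protecting encryption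
exposes the secret itself. A compound message that shows the secret is thus never carried by a
shielded one. -/
theorem Shielded.of_carriedBy {i a : ℕ} {t m : Msg} (h : Shielded i a m) (ht : t.CarriedBy m) :
    Shielded i a t ∨ t = random48 i := by
  induction m with
  | pair m₁ m₂ h₁ h₂ =>
    rcases ht with rfl | ht | ht
    · exact .inl h
    · exact h₁ h.1 ht
    · exact h₂ h.2 ht
  | enc m k h₁ _ =>
    rcases ht with rfl | ht
    · exact .inl h
    · rcases h with ⟨rfl, rfl⟩ | h
      · exact .inr ht
      · exact h₁ h ht
  | _ => cases ht; exact .inl h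

namespace Bundle

variable {B : Bundle M} {s : Strand} {k : ℕ} {m : Msg}

/-- Participants use exponents only inside group elements, so the penetrator gains no exponent from
them. -/
theorem Sends.not_expt (h : B.Sends s k m) (hs : s.Regular) (e : Expt) :
    ¬ (expt e).CarriedBy m := by
  rcases hs.cases with ⟨p, hp⟩ | ⟨ca, a, hp⟩
  · rcases M.tls_cases with ⟨x, hM⟩ | hM
    · rcases h.tls12 hp hM with ⟨-, ⟨-, rfl⟩ | ⟨-, rfl⟩ | ⟨-, -, rfl⟩ | ⟨-, -, rfl⟩⟩ |
        ⟨-, ⟨-, rfl⟩ | ⟨-, rfl⟩ | ⟨-, -, rfl⟩ | ⟨-, -, rfl⟩⟩ <;> cases x <;>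
        simp [TLS12.clientHello, TLS12.serverHello, TLS12.clientKeyExchange, TLS12.clientFinished,
          TLS12.serverFinished, certificate, finalChallenge, pubk]
    · rcases h.tls13 hp hM with ⟨-, ⟨-, rfl⟩ | ⟨-, rfl⟩ | ⟨-, -, rfl⟩ | ⟨-, -, rfl⟩⟩ |
        ⟨-, ⟨-, rfl⟩ | ⟨-, -, rfl⟩ | ⟨-, -, rfl⟩⟩ <;>
        simp [TLS13.clientHello, TLS13.serverHello, TLS13.clientFinished, TLS13.certificateVerify,
          TLS13.serverFinished, certificate, finalChallenge, pubk]
  · simp [h.certificateAuthority hp, certificate, pubk]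

/-- A participant sends only its own public value openly. The shared secret occurs only under hashes
or in key position, where it is not carried. -/
theorem Sends.dh_eq (h : B.Sends s k m) (hs : s.Regular) {e : Expt}
    (hd : (dh e).CarriedBy m) : ∃ i, e = rndx i := by
  rcases hs.cases with ⟨p, hp⟩ | ⟨ca, a, hp⟩
  · refine ⟨p.own, ?_⟩
    have hx : p.role.IsClient → p.vars.x = rndx p.own := by
      cases hr : p.role <;> simp [Role.IsClient, RoleInstance.vars, RoleInstance.x, hr]
    have hy : p.role.IsServer → p.vars.y = rndx p.own := by
      cases hr : p.role <;> simp [Role.IsServer, RoleInstance.vars, RoleInstance.y, hr]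
    rcases M.tls_cases with ⟨x, hM⟩ | hM
    · rcases h.tls12 hp hM with ⟨hR, ⟨-, rfl⟩ | ⟨-, rfl⟩ | ⟨-, -, rfl⟩ | ⟨-, -, rfl⟩⟩ |
        ⟨hR, ⟨-, rfl⟩ | ⟨-, rfl⟩ | ⟨-, -, rfl⟩ | ⟨-, -, rfl⟩⟩ <;> cases x <;>
        simp [TLS12.clientHello, TLS12.serverHello, TLS12.clientKeyExchange, TLS12.clientFinished,
          TLS12.serverFinished, certificate, finalChallenge, pubk] at hd <;>
        simp_all
    · rcases h.tls13 hp hM with ⟨hR, ⟨-, rfl⟩ | ⟨-, rfl⟩ | ⟨-, -, rfl⟩ | ⟨-, -, rfl⟩⟩ |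
        ⟨hR, ⟨-, rfl⟩ | ⟨-, -, rfl⟩ | ⟨-, -, rfl⟩⟩ <;>
        simp [TLS13.clientHello, TLS13.serverHello, TLS13.clientFinished, TLS13.certificateVerify,
          TLS13.serverFinished, certificate, finalChallenge, pubk] at hd <;>
        simp_all
  · simp [h.certificateAuthority hp, certificate, pubk] at hd

/-- The hashes that are sent are Finished values, the signed TLS 1.3 transcript, final challenges
and the registration key handle. None starts with a shared secret, and none bears a master-secret or
write-key label. -/
theorem Sends.not_keyMaterial (h : B.Sends s k m) (hs : s.Regular) {c : Msg}
    (hc : (Msg.hash c).CarriedBy m) : ¬ KeyMaterial c := by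
  rcases hs.cases with ⟨p, hp⟩ | ⟨ca, a, hp⟩
  · rcases M.tls_cases with ⟨x, hM⟩ | hM
    · rcases h.tls12 hp hM with ⟨-, ⟨-, rfl⟩ | ⟨-, rfl⟩ | ⟨-, -, rfl⟩ | ⟨-, -, rfl⟩⟩ |
        ⟨-, ⟨-, rfl⟩ | ⟨-, rfl⟩ | ⟨-, -, rfl⟩ | ⟨-, -, rfl⟩⟩ <;> cases x <;>
        simp [TLS12.clientHello, TLS12.serverHello, TLS12.clientKeyExchange, TLS12.clientFinished,
          TLS12.serverFinished, TLS12.master, certificate, finalChallenge, pubk] at hc <;>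
        (try rcases hc with rfl | rfl) <;> simp [KeyMaterial]
    · rcases h.tls13 hp hM with ⟨-, ⟨-, rfl⟩ | ⟨-, rfl⟩ | ⟨-, -, rfl⟩ | ⟨-, -, rfl⟩⟩ |
        ⟨-, ⟨-, rfl⟩ | ⟨-, -, rfl⟩ | ⟨-, -, rfl⟩⟩ <;>
        simp [TLS13.clientHello, TLS13.serverHello, TLS13.clientFinished, TLS13.certificateVerify,
          TLS13.serverFinished, TLS13.handshakeSecret, certificate, finalChallenge, pubk] at hc <;>
        (try rcases hc with rfl | rfl) <;> simp [KeyMaterial]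
  · simp [h.certificateAuthority hp, certificate, pubk] at hc

theorem Sends.shielded (h : B.Sends s k m) (hs : s.Regular) {i a : ℕ} (hM : M.tls = .tls12RSA)
    (hi : ∀ p, s.actor = .participant p → p.role.IsClient → k = 2 → p.pms = i → p.server = a) :
    Shielded i a m := by
  rcases hs.cases with ⟨p, hp⟩ | ⟨ca, b, hp⟩
  · specialize hi p hp
    rcases h.tls12 (x := .rsa) hp hM with ⟨hR, ⟨-, rfl⟩ | ⟨rfl, rfl⟩ | ⟨-, -, rfl⟩ | ⟨-, -, rfl⟩⟩ |
        ⟨-, ⟨-, rfl⟩ | ⟨-, rfl⟩ | ⟨-, -, rfl⟩ | ⟨-, -, rfl⟩⟩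
    case inl.inl.inr.inl =>
      refine ⟨?_, .inr trivial⟩
      by_cases hpi : p.pms = i
      · exact .inl ⟨by simp [RoleInstance.vars, hpi], by simp [RoleInstance.vars, hi hR rfl hpi]⟩
      · exact .inr hpi
    all_goals
      apply shielded_of_not_carriedBy
      simp [TLS12.clientHello, TLS12.serverHello, TLS12.clientFinished,
          TLS12.serverFinished, certificate, finalChallenge, pubk]
  · apply shielded_of_not_carriedBy
    simp [h.certificateAuthority hp, certificate, pubk]

/-- A pair of a name and a text is encrypted only in the authentication challenge: the registration
challenge has a pair as its second component, and Finished contents are hashes. The challenge is the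
last but one message of the run. -/
theorem Sends.challenge (h : B.Sends s k m) (hs : s.Regular) {a c : ℕ} {v : Vars}
    (ht : (enc (pair (name a) (text c)) (writeKey M v .serverWriteKey)).CarriedBy m) :
    ∃ p, s.actor = .participant p ∧ p.role = .serverAuth ∧ k + 2 = p.role.height M ∧
      p.appid = a ∧ p.challenge = c ∧
      writeKey M p.vars .serverWriteKey = writeKey M v .serverWriteKey := by
  rcases hs.cases with ⟨p, hp⟩ | ⟨ca, b, hp⟩
  · refine ⟨p, hp, ?_⟩
    rcases M.tls_cases with ⟨x, hM⟩ | hM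
    · rw [writeKey_tls12 hM, writeKey_tls12 hM]
      rw [writeKey_tls12 hM] at ht
      rcases h.tls12 hp hM with ⟨-, ⟨-, rfl⟩ | ⟨-, rfl⟩ | ⟨-, -, rfl⟩ | ⟨-, -, rfl⟩⟩ |
        ⟨-, ⟨-, rfl⟩ | ⟨-, rfl⟩ | ⟨-, -, rfl⟩ | ⟨hr, rfl, rfl⟩⟩
      case inl.inl.inr.inr.inr.inr =>
        simp at ht
        obtain ⟨⟨rfl, rfl⟩, h2⟩ := ht
        refine ⟨hr, ?_, rfl, rfl, h2.symm⟩
        cases x <;> simp [Role.height, hM, KeyExchange.tls]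
      all_goals
        exfalso
        cases x <;>
        simp [TLS12.clientHello, TLS12.serverHello, TLS12.clientKeyExchange, TLS12.clientFinished,
          TLS12.serverFinished, TLS12.writeKey, certificate, finalChallenge, pubk, privk] at ht <;>
        simpa [pubk] using (enc_carriedBy_helloExtension ht).1
    · rw [writeKey_tls13 hM, writeKey_tls13 hM]
      rw [writeKey_tls13 hM] at ht
      rcases h.tls13 hp hM with ⟨-, ⟨-, rfl⟩ | ⟨-, rfl⟩ | ⟨-, -, rfl⟩ | ⟨-, -, rfl⟩⟩ |
        ⟨-, ⟨-, rfl⟩ | ⟨-, -, rfl⟩ | ⟨hr, rfl, rfl⟩⟩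
      case inl.inr.inr.inr.inr =>
        simp at ht
        obtain ⟨⟨rfl, rfl⟩, h2⟩ := ht
        refine ⟨hr, ?_, rfl, rfl, h2.symm⟩
        simp [Role.height, hM]
      all_goals
        exfalso
        simp [TLS13.clientHello, TLS13.serverHello, TLS13.clientFinished, TLS13.certificateVerify,
          TLS13.serverFinished, TLS13.writeKey, certificate, finalChallenge, pubk, privk] at ht <;>
        simpa [pubk] using (enc_carriedBy_helloExtension ht).1
  · simp [h.certificateAuthority hp, certificate, pubk] at ht

/-- The label inside the Finished hash separates it from the server's Finished message. The sender
need not have the variables `v`; only the hashed transcripts agree. -/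
theorem Sends.clientFinished (h : B.Sends s k m) (hs : s.Regular) {x : KeyExchange}
    (hM : M.tls = x.tls) {v : Vars}
    (ht : (enc (TLS12.clientFinished M x v) (writeKey M v .clientWriteKey)).CarriedBy m) :
    ∃ p, s.actor = .participant p ∧ p.role.IsClient ∧
      TLS12.clientFinished M x p.vars = TLS12.clientFinished M x v := by
  rw [writeKey_tls12 hM] at ht
  rcases hs.cases with ⟨p, hp⟩ | ⟨ca, b, hp⟩
  · refine ⟨p, hp, ?_⟩
    rcases h.tls12 hp hM with ⟨hR, ⟨-, rfl⟩ | ⟨-, rfl⟩ | ⟨-, -, rfl⟩ | ⟨-, -, rfl⟩⟩ |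
        ⟨-, ⟨-, rfl⟩ | ⟨-, rfl⟩ | ⟨-, -, rfl⟩ | ⟨-, -, rfl⟩⟩
    case inl.inl.inr.inl =>
      refine ⟨hR, ?_⟩
      simp only [carriedBy_pair, reduceCtorEq, false_or, carriedBy_enc] at ht
      rcases ht with ht | ht | ht
      · cases x <;> simp [TLS12.clientKeyExchange, TLS12.clientFinished] at ht
      · exact (enc.inj ht).1.symm
      · simp [TLS12.clientFinished] at ht
    all_goals
      exfalso
      cases x <;>
      simp [TLS12.clientHello, TLS12.serverHello, TLS12.clientKeyExchange, TLS12.clientFinished,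
          TLS12.serverFinished, TLS12.writeKey, certificate, finalChallenge, pubk, privk] at ht <;>
      simpa [pubk] using (enc_carriedBy_helloExtension ht).1
  · simp [h.certificateAuthority hp, certificate, pubk, TLS12.clientFinished] at ht

/-- Only the TLS 1.2 DH server hello contains a signature of this shape, and it covers the server's
public value. -/
theorem Sends.keyExchangeSignature (h : B.Sends s k m) (hs : s.Regular) {cr sr a : ℕ} {e : Expt}
    (ht : (enc (pair (random32 cr) (pair (random32 sr) (dh e))) (privk a)).CarriedBy m) :
    ∃ p, s.actor = .participant p ∧ p.role.IsServer ∧ p.y = e := by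
  rcases hs.cases with ⟨p, hp⟩ | ⟨ca, b, hp⟩
  · refine ⟨p, hp, ?_⟩
    rcases M.tls_cases with ⟨x, hM⟩ | hM
    · rcases h.tls12 hp hM with ⟨-, ⟨-, rfl⟩ | ⟨-, rfl⟩ | ⟨-, -, rfl⟩ | ⟨-, -, rfl⟩⟩ |
        ⟨hR, ⟨-, rfl⟩ | ⟨-, rfl⟩ | ⟨-, -, rfl⟩ | ⟨hr, rfl, rfl⟩⟩ <;> cases x <;>
        simp [TLS12.clientHello, TLS12.serverHello, TLS12.clientKeyExchange, TLS12.clientFinished,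
          TLS12.serverFinished, TLS12.writeKey, certificate, finalChallenge, pubk, privk] at ht
      case inl.inl.inr.inl.dh => exact ⟨hR, ht.1.2.2.symm⟩
      all_goals simpa [pubk] using (enc_carriedBy_helloExtension ht).1
    · rcases h.tls13 hp hM with ⟨-, ⟨-, rfl⟩ | ⟨-, rfl⟩ | ⟨-, -, rfl⟩ | ⟨-, -, rfl⟩⟩ |
        ⟨-, ⟨-, rfl⟩ | ⟨-, -, rfl⟩ | ⟨hr, rfl, rfl⟩⟩ <;>
        simp [TLS13.clientHello, TLS13.serverHello, TLS13.clientFinished, TLS13.certificateVerify,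
          TLS13.serverFinished, TLS13.writeKey, certificate, finalChallenge, pubk, privk] at ht
      simpa [pubk] using (enc_carriedBy_helloExtension ht).1
  · simp [h.certificateAuthority hp, certificate, pubk] at ht

/-- The signed transcript hash includes the server hello, hence the server's key share. -/
theorem Sends.certificateVerify (h : B.Sends s k m) (hs : s.Regular) {v : Vars}
    (ht : (TLS13.certificateVerify M v).CarriedBy m) :
    ∃ p, s.actor = .participant p ∧ p.role.IsServer ∧ p.y = v.y := by
  rcases hs.cases with ⟨p, hp⟩ | ⟨ca, b, hp⟩
  · refine ⟨p, hp, ?_⟩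
    rcases M.tls_cases with ⟨x, hM⟩ | hM
    · rcases h.tls12 hp hM with ⟨-, ⟨-, rfl⟩ | ⟨-, rfl⟩ | ⟨-, -, rfl⟩ | ⟨-, -, rfl⟩⟩ |
        ⟨-, ⟨-, rfl⟩ | ⟨-, rfl⟩ | ⟨-, -, rfl⟩ | ⟨-, -, rfl⟩⟩ <;> cases x <;>
        simp [TLS12.clientHello, TLS12.serverHello, TLS12.clientKeyExchange, TLS12.clientFinished,
          TLS12.serverFinished, TLS12.writeKey, TLS13.certificateVerify, certificate,
          finalChallenge, pubk, privk] at ht <;>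
        simpa [pubk] using (enc_carriedBy_helloExtension ht).1
    · rcases h.tls13 hp hM with ⟨-, ⟨-, rfl⟩ | ⟨-, rfl⟩ | ⟨-, -, rfl⟩ | ⟨-, -, rfl⟩⟩ |
        ⟨hR, ⟨-, rfl⟩ | ⟨-, -, rfl⟩ | ⟨-, -, rfl⟩⟩ <;>
        simp [TLS13.clientHello, TLS13.serverHello, TLS13.clientFinished, TLS13.certificateVerify,
          TLS13.serverFinished, TLS13.writeKey, certificate, finalChallenge, pubk, privk] at ht
      case inl.inr.inr.inl => exact ⟨hR, ht.1.2.1.2.symm⟩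
      all_goals simpa [pubk] using (enc_carriedBy_helloExtension ht).1
  · simp [h.certificateAuthority hp, certificate, pubk, TLS13.certificateVerify] at ht

end Bundle

/-! ### Exponents and events of the participants -/

theorem RoleInstance.x_of_isClient {p : RoleInstance} (h : p.role.IsClient) :
    p.x = UAF.rndx p.own := by
  cases hr : p.role <;> simp_all [Role.IsClient, RoleInstance.x]

theorem RoleInstance.y_of_isServer {p : RoleInstance} (h : p.role.IsServer) :
    p.y = UAF.rndx p.own := by
  cases hr : p.role <;> simp_all [Role.IsServer, RoleInstance.y]

theorem rndx_injective : Function.Injective rndx := Finsupp.single_left_injective one_ne_zero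

namespace Strand

variable {s : Strand} {p : RoleInstance}

theorem event?_client_zero (hs : s.actor = .participant p) (hp : p.role.IsClient) :
    ∃ m, Node.event? M ⟨s, 0⟩ = some (.send m) ∧ (random32 p.cr).CarriedBy m := by
  rw [event?_participant hs]
  rcases M.tls_cases with ⟨x, hM⟩ | hM <;> cases hr : p.role
  all_goals first
    | simp [hr, Role.IsClient] at hp; done
    | simp [RoleInstance.trace, Role.trace, Role.steps, handshake_tls12 hM, hr,
        TLS12.handshake, Step.clientEvent, TLS12.clientHello, RoleInstance.vars]
    | simp [RoleInstance.trace, Role.trace, Role.steps, handshake_tls13 hM, hr,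
        TLS13.handshake, Step.clientEvent, TLS13.clientHello, RoleInstance.vars]

theorem event?_client_challenge (hs : s.actor = .participant p) (hp : p.role = .clientAuth)
    {k : ℕ} (hk : k + 2 = p.role.height M) :
    Node.event? M ⟨s, k⟩ = some (.recv (enc (pair (name p.appid) (text p.challenge))
      (writeKey M p.vars .serverWriteKey))) := by
  rw [event?_participant hs]
  rcases M.tls_cases with ⟨x, hM⟩ | hM
  · obtain rfl : k = 4 := by cases x <;> simp_all [Role.height, KeyExchange.tls]
    simp [hp, RoleInstance.trace, Role.trace, Role.steps, handshake_tls12 hM,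
      TLS12.handshake, Step.clientEvent, authentication, RoleInstance.vars]
  · obtain rfl : k = 3 := by simp_all [Role.height]
    simp [hp, RoleInstance.trace, Role.trace, Role.steps, handshake_tls13 hM,
      TLS13.handshake, Step.clientEvent, authentication, RoleInstance.vars]

theorem event?_client_tls12 (hs : s.actor = .participant p) (hp : p.role.IsClient)
    {x : KeyExchange} (hM : M.tls = x.tls) :
    Node.event? M ⟨s, 0⟩ = some (.send (TLS12.clientHello M p.vars)) ∧
    Node.event? M ⟨s, 1⟩ = some (.recv (TLS12.serverHello x p.vars)) := by
  rw [event?_participant hs, event?_participant hs]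
  cases hr : p.role <;>
    simp_all [Role.IsClient, RoleInstance.trace, Role.trace, Role.steps, handshake_tls12 hM,
      TLS12.handshake, Step.clientEvent]

theorem event?_client_tls13 (hs : s.actor = .participant p) (hp : p.role.IsClient)
    (hM : M.tls = .tls13) :
    Node.event? M ⟨s, 1⟩ = some (.recv (cat (TLS13.serverHello p.vars)
          [enc (cat (certificate p.server p.ca)
            [TLS13.certificateVerify M p.vars, TLS13.serverFinished M p.vars])
            (TLS13.handshakeKey M p.vars .serverHandshakeKey)])) := by
  rw [event?_participant hs]
  cases hr : p.role <;>
    simp_all [Role.IsClient, RoleInstance.trace, Role.trace, Role.steps, handshake_tls13 hM,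
      TLS13.handshake, Step.clientEvent, RoleInstance.vars]

theorem event?_server_clientFinished (hs : s.actor = .participant p) (hp : p.role.IsServer)
    {x : KeyExchange} (hM : M.tls = x.tls) :
    Node.event? M ⟨s, 2⟩ = some (.recv (pair (TLS12.clientKeyExchange x p.vars)
      (enc (TLS12.clientFinished M x p.vars) (writeKey M p.vars .clientWriteKey)))) := by
  rw [event?_participant hs]
  cases hr : p.role <;>
    simp_all [Role.IsServer, RoleInstance.trace, Role.trace, Role.steps, handshake_tls12 hM,
      TLS12.handshake, Step.serverEvent, writeKey_tls12 hM]

/-- This locates the origination of the server random, and the first use of the server's exponent,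
at the second node: the only earlier message is the client hello, whose only nonce is the client
random. -/
theorem event?_server_zero_one (hs : s.actor = .participant p) (hp : p.role.IsServer) :
    (∃ m, Node.event? M ⟨s, 0⟩ = some (.recv m) ∧
      ∀ i, (random32 i).CarriedBy m → i = p.cr) ∧
    ∃ m, Node.event? M ⟨s, 1⟩ = some (.send m) ∧ (random32 p.sr).CarriedBy m ∧
      (M.tls ≠ .tls12RSA → m.HasRndx p.own) := by
  rw [event?_participant hs, event?_participant hs]
  have hy := RoleInstance.y_of_isServer hp
  rcases M.tls_cases with ⟨x, hM⟩ | hM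
  · cases hr : p.role <;> cases x <;>
      simp_all [Role.IsServer, RoleInstance.trace, Role.trace, Role.steps, handshake_tls12 hM,
        TLS12.handshake, Step.serverEvent, TLS12.clientHello, TLS12.serverHello,
        RoleInstance.vars, HasRndx, KeyExchange.tls, UAF.rndx]
  · cases hr : p.role <;>
      simp_all [Role.IsServer, RoleInstance.trace, Role.trace, Role.steps, handshake_tls13 hM,
        TLS13.handshake, Step.serverEvent, TLS13.clientHello, TLS13.serverHello,
        RoleInstance.vars, HasRndx, UAF.rndx]

end Strand

/-! ### Freshness, secrecy of the keys, and the partner -/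

namespace Bundle

variable {B : Bundle M} {s t : Strand} {p q : RoleInstance}

theorem UniquelyGenerates.strand_eq {i : ℕ} (hs : B.UniquelyGenerates s i)
    (ht : B.UniquelyGenerates t i) : t = s := by
  obtain ⟨n, rfl, -, -, hn⟩ := hs
  obtain ⟨n', rfl, hb, hg, -⟩ := ht
  rw [hn n' hb hg]

/-- A penetrator strand that emits the exponent would be a second place of generation. -/
theorem UniquelyGenerates.not_penetrator {i : ℕ} (h : B.UniquelyGenerates s i)
    (hs : s.actor = .participant p) (ht : t.actor = .penetrator (.rndx i)) :
    ¬ B.HasNode ⟨t, 0⟩ := by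
  obtain ⟨n, rfl, -, -, hn⟩ := h
  intro hb
  have : Node.mk t 0 = n := hn _ hb
    ⟨⟨_, by rw [Strand.event?_penetrator ht]; rfl, by simp [HasRndx, rndx]⟩, by simp⟩
  subst this
  simp [ht] at hs

theorem ServersFresh.uniquelyGenerates (hB : B.ServersFresh) (hM : M.tls ≠ .tls12RSA)
    (hs : s.actor = .participant p) (hp : p.role.IsServer) (h1 : B.HasNode ⟨s, 1⟩) :
    B.UniquelyGenerates s p.own := by
  obtain ⟨-, m, hm, -, hr⟩ := Strand.event?_server_zero_one (M := M) hs hp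
  exact hB hM s p hs hp ⟨1, m, h1, hm, hr hM⟩

/-- A client random that originates uniquely determines the client strand. -/
theorem UniquelyOriginates.client_eq (h : B.UniquelyOriginates s (random32 p.cr))
    (ht : t.actor = .participant p) (hp : p.role.IsClient) (hb : B.HasStrand t) : t = s := by
  obtain ⟨n, rfl, -, -, hn⟩ := h
  obtain ⟨m, hm, hc⟩ := Strand.event?_client_zero (M := M) ht hp
  rw [← hn ⟨t, 0⟩ hb ⟨⟨m, hm, hc⟩, by simp⟩]

/-- A server random that originates uniquely determines the server strand. -/
theorem UniquelyOriginates.server_eq (h : B.UniquelyOriginates s (random32 p.sr))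
    (ht : t.actor = .participant p) (hp : p.role.IsServer) (hne : p.sr ≠ p.cr)
    (hb : B.HasNode ⟨t, 1⟩) : t = s := by
  obtain ⟨n, rfl, -, -, hn⟩ := h
  obtain ⟨⟨m₀, h₀, hc₀⟩, m, hm, hc, -⟩ := Strand.event?_server_zero_one (M := M) ht hp
  rw [← hn ⟨t, 1⟩ hb ⟨⟨m, hm, hc⟩, ?_⟩]
  -- Only the received client hello precedes, and it could carry the server random only if that
  -- equalled the client random.
  intro k hk e he hce
  obtain rfl : k = 0 := by simpa using hk
  simp only [h₀, Option.some.injEq] at he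
  subst he
  exact hne (hc₀ _ hce)

/-- Unique origination excludes the penetrator and all other clients as sources of the premaster
secret, and removing the encryption would take the server's private key. -/
theorem forall_shielded (hM : M.tls = .tls12RSA) (hs : s.actor = .participant p)
    (hk : B.NonOriginating (privk p.server))
    (hu : B.UniquelyOriginates s (random48 p.pms)) :
    ∀ n, B.HasNode n → ∀ e, n.event? M = some e → Shielded p.pms p.server e.msg := by
  obtain ⟨n, rfl, -, -, hn⟩ := hu
  refine B.forall_msg_of_closed ?_ ?_ ?_ ?_ ?_ ?_ ?_ ?_ ?_ ?_ ?_ ?_ ?_ ?_ ?_ ?_ ?_ ?_ ?_ ?_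
  · intro t k m ht hm _
    refine hm.shielded ht hM fun q hq hr h2 hpms => ?_
    subst h2
    obtain ⟨h0, h1⟩ := Strand.event?_client_tls12 (M := M) hq hr (x := .rsa) hM
    -- Any client that sends this premaster secret in its key exchange originates it there, since
    -- its two earlier messages carry no `random48`. So that client is `s` itself, with the same
    -- server.
    have : Node.mk t 2 = n := by
      refine hn _ hm.1 ⟨⟨m, hm.2, ?_⟩, ?_⟩
      · rcases hm.tls12 hq (x := .rsa) hM with
          ⟨-, ⟨h, -⟩ | ⟨-, rfl⟩ | ⟨-, h, -⟩ | ⟨-, h, -⟩⟩ |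
          ⟨-, ⟨h, -⟩ | ⟨h, -⟩ | ⟨-, h, -⟩ | ⟨-, h, -⟩⟩
        case inl.inr.inl => simp [TLS12.clientKeyExchange, RoleInstance.vars, hpms]
        all_goals omega
      · intro l hl e he
        obtain rfl | rfl : l = 0 ∨ l = 1 := by simp at hl; omega
        · simp only [h0, Option.some.injEq] at he
          subst he
          simp [TLS12.clientHello, Event.msg]
        · simp only [h1, Option.some.injEq] at he
          subst he
          simp [TLS12.serverHello, Event.msg, certificate, pubk]
    subst this
    rw [hs] at hq
    cases hq
    rfl
  case refine_6 =>
    rintro t i ht hb rfl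
    have : Node.mk t 0 = n := hn _ hb
      ⟨⟨_, by rw [Strand.event?_penetrator ht]; rfl, by simp⟩, by simp⟩
    subst this
    simp [ht] at hs
  case refine_15 => exact fun _ _ => And.intro
  case refine_16 => exact fun _ _ => And.left
  case refine_17 => exact fun _ _ => And.right
  case refine_18 => exact fun _ _ _ _ _ h _ => .inr h
  case refine_19 =>
    rintro t m k ht hb (⟨rfl, rfl⟩ | h) -
    · refine absurd (carriedBy_refl _) (hk _ hb (.recv (privk p.server)) ?_)
      rw [Strand.event?_penetrator ht]; rfl
    · exact h
  all_goals intros; trivial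

/-- The statement is about the input of the master-secret hash, because the premaster secret itself
is carried, in encrypted form, by the key exchange message. -/
theorem nonOriginating_of_pms (hM : M.tls = .tls12RSA) (hs : s.actor = .participant p)
    (hk : B.NonOriginating (privk p.server))
    (hu : B.UniquelyOriginates s (random48 p.pms)) (m : Msg) :
    B.NonOriginating (pair (random48 p.pms) m) := by
  intro n hn e he hc
  have := (forall_shielded hM hs hk hu n hn e he).of_carriedBy hc
  simp [Shielded] at this

/-- A shared DH secret of two exponents that the penetrator does not generate is not disclosed. -/
theorem nonOriginating_dh {a b : ℕ} (hab : a ≠ b)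
    (ha : ∀ t, t.actor = .penetrator (.rndx a) → ¬ B.HasNode ⟨t, 0⟩)
    (hb : ∀ t, t.actor = .penetrator (.rndx b) → ¬ B.HasNode ⟨t, 0⟩) :
    B.NonOriginating (dh (rndx a + rndx b)) := by
  -- The invariant is the total degree in `a` and `b`. Exponents in the penetrator's reach have
  -- degree 0, and public values of participants have degree at most 1, which exponentiation
  -- preserves. The shared secret has degree 2.
  have key : ∀ n, B.HasNode n → ∀ e, n.event? M = some e →
      (∀ f, (expt f).CarriedBy e.msg → f a + f b = 0) ∧
      (∀ f, (dh f).CarriedBy e.msg → f a + f b ≤ 1) := by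
    refine B.forall_msg_of_closed (Q := fun m => (∀ f, (expt f).CarriedBy m → f a + f b = 0) ∧
      (∀ f, (dh f).CarriedBy m → f a + f b ≤ 1))
      ?_ ?_ ?_ ?_ ?_ ?_ ?_ ?_ ?_ ?_ ?_ ?_ ?_ ?_ ?_ ?_ ?_ ?_ ?_ ?_
    · intro t k m ht hm _
      refine ⟨fun f hf => absurd hf (hm.not_expt ht f), fun f hf => ?_⟩
      obtain ⟨i, rfl⟩ := hm.dh_eq ht hf
      simp only [rndx, Finsupp.single_apply]
      split_ifs <;> omega
    case refine_11 =>
      intro t i ht h0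
      have hia : i ≠ a := by rintro rfl; exact ha t ht h0
      have hib : i ≠ b := by rintro rfl; exact hb t ht h0
      simp [rndx, hia, hib]
    case refine_12 =>
      rintro e f ⟨he, -⟩ ⟨hf, -⟩
      have he := he e (carriedBy_refl _)
      have hf := hf f (carriedBy_refl _)
      simp
      omega
    case refine_13 =>
      rintro e ⟨he, -⟩
      have he := he e (carriedBy_refl _)
      simp
      omega
    case refine_14 =>
      rintro e f ⟨-, he⟩ ⟨hf, -⟩
      have he := he e (carriedBy_refl _)
      have hf := hf f (carriedBy_refl _)
      simp
      omega
    case refine_15 =>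
      rintro m₁ m₂ ⟨h₁, h₁'⟩ ⟨h₂, h₂'⟩
      simp only [carriedBy_pair, reduceCtorEq, false_or]
      exact ⟨fun f hf => hf.elim (h₁ f) (h₂ f), fun f hf => hf.elim (h₁' f) (h₂' f)⟩
    all_goals simp +contextual
  intro n hn e he hc
  have := (key n hn e he).2 _ hc
  simp [rndx, hab, hab.symm] at this

/-- This is the inductive step of the key schedule: a key derived from a secret is again secret,
because the penetrator cannot compute it and participants do not send it. -/
theorem NonOriginating.hash {a c : Msg} (ha : B.NonOriginating a) (hac : a.CarriedBy c)
    (hk : KeyMaterial c) : B.NonOriginating (.hash c) := by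
  have hc := ha.mono hac
  intro n hn e he ht
  obtain ⟨t, k, m, hr, hm, h⟩ := B.exists_regular_sends (.inl rfl) hc hn he ht
  exact hm.not_keyMaterial hr h hk

/-- The server exponent of a client is the exponent of a server strand. -/
theorem exists_server_exponent (hM : M.tls ≠ .tls12RSA) (hs : s.actor = .participant p)
    (hp : p.role.IsClient) (hb : B.HasNode ⟨s, 1⟩)
    (hk : B.NonOriginating (privk p.server)) :
    ∃ t q, t.actor = .participant q ∧ q.role.IsServer ∧ B.HasNode ⟨t, 1⟩ ∧ q.y = p.y := by
  -- A server's first node is a reception, so a server that has sent anything has reached its second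
  -- node, where its exponent is used.
  have hone : ∀ {t k m q}, B.Sends t k m → t.actor = .participant q → q.role.IsServer →
      B.HasNode ⟨t, 1⟩ := by
    intro t k m q hm ht hq
    rcases Nat.eq_zero_or_pos k with rfl | h
    · obtain ⟨⟨m', h0, -⟩, -⟩ := Strand.event?_server_zero_one (M := M) ht hq
      simp [Sends, h0] at hm
    · exact lt_of_le_of_lt h hm.1
  rcases M.tls_cases with ⟨x, hM'⟩ | hM'
  · cases x
    · exact absurd hM' hM
    obtain ⟨-, h1⟩ := Strand.event?_client_tls12 hs hp hM'
    obtain ⟨t, k, m, hr, hm, hc⟩ := B.exists_regular_sends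
      (t := enc (pair (random32 p.cr) (pair (random32 p.sr) (dh p.y))) (privk p.server))
      (.inr ⟨_, rfl⟩) hk hb h1 (by simp [Event.msg, TLS12.serverHello, RoleInstance.vars])
    obtain ⟨q, hq, hqr, hy⟩ := hm.keyExchangeSignature hr hc
    exact ⟨t, q, hq, hqr, hone hm hq hqr, hy⟩
  · have h1 := Strand.event?_client_tls13 hs hp hM'
    obtain ⟨t, k, m, hr, hm, hc⟩ := B.exists_regular_sends
      (t := TLS13.certificateVerify M p.vars)
      (.inr ⟨_, rfl⟩) hk hb h1 (by simp [Event.msg, TLS13.certificateVerify])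
    obtain ⟨q, hq, hqr, hy⟩ := hm.certificateVerify hr hc
    exact ⟨t, q, hq, hqr, hone hm hq hqr, hy⟩

/-- The write keys of a client are secret. -/
theorem nonOriginating_writeKey (hB : B.ServersFresh) (hs : s.actor = .participant p)
    (hp : p.role.IsClient) (hb : B.HasNode ⟨s, 1⟩) (hA : clientAssumptions M B s p) {l : Tag}
    (hl : l = .clientWriteKey ∨ l = .serverWriteKey) :
    B.NonOriginating (writeKey M p.vars l) := by
  obtain ⟨-, hk, -, -, hpms, hown⟩ := hA
  by_cases hM : M.tls = .tls12RSA
  · rw [writeKey_tls12 (k := .rsa) hM]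
    have hms : B.NonOriginating (TLS12.master .rsa p.vars) :=
      (nonOriginating_of_pms hM hs hk (hpms hM)
        (cat (tag .masterSecret) [random32 p.cr, random32 p.sr])).hash (carriedBy_refl _) trivial
    exact hms.hash (by simp [carriedBy_refl]) (by rcases hl with rfl | rfl <;> trivial)
  · have hsec : B.NonOriginating (dh (p.x + p.y)) := by
      obtain ⟨t, q, ht, hq, hb1, hy⟩ := exists_server_exponent hM hs hp hb hk
      have hg := hB.uniquelyGenerates hM ht hq hb1
      rw [← hy, RoleInstance.y_of_isServer hq, RoleInstance.x_of_isClient hp]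
      refine nonOriginating_dh ?_ (fun _ => (hown hM).not_penetrator hs)
        (fun _ => hg.not_penetrator ht)
      -- Equal exponents would be generated on one strand, which would then be both a client and a
      -- server.
      intro hpq
      rw [← hpq] at hg
      obtain rfl := (hown hM).strand_eq hg
      rw [hs] at ht
      cases ht
      cases hr : p.role <;> simp_all [Role.IsClient, Role.IsServer]
    rcases M.tls_cases with ⟨x, hM'⟩ | hM'
    · cases x
      · exact absurd hM' hM
      rw [writeKey_tls12 hM']
      have hms : B.NonOriginating (TLS12.master .dh p.vars) :=
        hsec.hash (by simp [TLS12.secret, RoleInstance.vars]) trivial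
      exact hms.hash (by simp [carriedBy_refl]) (by rcases hl with rfl | rfl <;> trivial)
    · rw [writeKey_tls13 hM']
      have hhs : B.NonOriginating (TLS13.handshakeSecret p.vars) :=
        hsec.hash (by simp [RoleInstance.vars]) trivial
      have hms : B.NonOriginating (TLS13.master p.vars) :=
        hhs.hash (by simp [carriedBy_refl]) trivial
      exact hms.hash (by simp [carriedBy_refl]) (by rcases hl with rfl | rfl <;> trivial)

/-- Every completed client has a server that has sent the challenge to it. -/
theorem exists_partner (hB : B.ServersFresh) (hs : s.actor = .participant p)
    (hp : p.role = .clientAuth) (hh : p.role.height M ≤ B.height s)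
    (hA : clientAssumptions M B s p) :
    ∃ t q, t.actor = .participant q ∧ q.role = .serverAuth ∧
      q.role.height M ≤ B.height t + 1 ∧ authContext M p q := by
  have hpc : p.role.IsClient := by rw [hp]; trivial
  have h5 : 5 ≤ p.role.height M := by
    unfold Role.height; split <;> omega
  have hb1 : B.HasNode ⟨s, 1⟩ := show 1 < B.height s by omega
  -- The challenge is the last but one event, hence at index height minus 2.
  obtain ⟨k, hk⟩ : ∃ k, k + 2 = p.role.height M := ⟨p.role.height M - 2, by omega⟩
  have hb : B.HasNode ⟨s, k⟩ := show k < B.height s by omega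
  obtain ⟨t, k', m, htr, hm, hc⟩ := B.exists_regular_sends (.inr ⟨_, rfl⟩)
    (nonOriginating_writeKey hB hs hpc hb1 hA (.inr rfl)) hb
    (Strand.event?_client_challenge hs hp hk) (carriedBy_refl _)
  obtain ⟨q, hq, hqr, hk', ha, hch, hkey⟩ := hm.challenge htr hc
  have hbt : k' < B.height t := hm.1
  -- The server has executed index height minus 2, so all but at most its last event have occurred.
  refine ⟨t, q, hq, hqr, by omega, ?_⟩
  have hqs : q.role.IsServer := by rw [hqr]; trivial
  suffices h : p.server = q.server ∧ p.ca = q.ca ∧ p.cr = q.cr ∧ p.sr = q.sr ∧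
      (M.tls = .tls12RSA → p.pms = q.pms) ∧ (M.tls ≠ .tls12RSA → p.x = q.x ∧ p.y = q.y) from
    ⟨h, hch.symm, h.1, ha.symm⟩
  rcases M.tls_cases with ⟨x, hM⟩ | hM
  · have hkey' : writeKey M q.vars .clientWriteKey = writeKey M p.vars .clientWriteKey := by
      rw [writeKey_tls12 hM, writeKey_tls12 hM] at hkey ⊢
      simpa [TLS12.writeKey] using hkey
    have hcr : q.cr = p.cr := by
      rw [writeKey_tls12 hM, writeKey_tls12 hM] at hkey
      simp [TLS12.writeKey] at hkey
      exact hkey.2.1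
    have hq6 : q.role.height M = 6 := by cases x <;> simp [Role.height, hM, KeyExchange.tls]
    have hb2 : B.HasNode ⟨t, 2⟩ := show 2 < B.height t by omega
    -- Second test, now from the server's side: the Finished message it received under the secret
    -- client write key must stem from a client, which its client random identifies as `s`.
    obtain ⟨u, l, m', hur, hm', hc'⟩ := B.exists_regular_sends
      (t := enc (TLS12.clientFinished M x q.vars) (writeKey M q.vars .clientWriteKey))
      (.inr ⟨_, rfl⟩)
      (hkey' ▸ nonOriginating_writeKey hB hs hpc hb1 hA (.inl rfl)) hb2
      (Strand.event?_server_clientFinished hq hqs hM) (.inr (.inr (carriedBy_refl _)))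
    obtain ⟨r, hr, hrc, hfin⟩ := hm'.clientFinished hur hM hc'
    have hrcr : r.cr = q.cr := by
      simp [TLS12.clientFinished, TLS12.clientHello] at hfin
      exact hfin.2.1.1
    have hus : u = s := by
      refine UniquelyOriginates.client_eq (p := r) ?_ hr hrc
        (Nat.zero_lt_of_lt (show l < B.height u from hm'.1))
      rw [hrcr, hcr]
      exact hA.2.2.2.1
    subst hus
    rw [hs] at hr
    cases hr
    cases x <;>
      simp [TLS12.clientFinished, TLS12.clientHello, TLS12.serverHello, TLS12.clientKeyExchange,
        certificate, RoleInstance.vars, pubk, privk] at hfin <;>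
      simp [hM, KeyExchange.tls, hfin]
  · rw [writeKey_tls13 hM, writeKey_tls13 hM] at hkey
    simp [TLS13.writeKey, TLS13.transcript, TLS13.clientHello, TLS13.serverHello, certificate,
      pubk, privk, RoleInstance.vars] at hkey
    simp [hM, hkey]

end Bundle

/-! ### An undisturbed session, which determines the partner role -/

/-- A client in a session with the server `honestServer`. -/
noncomputable def honestClient : RoleInstance where
  role := .clientAuth
  server := 0
  ca := 1
  client := 2
  username := 3
  appid := 4
  aaid := 5
  authk := .free 0
  challenge := 0
  n := 1
  cr := 0
  sr := 1
  pms := 0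
  -- The exponents of the two ends must differ, so that each first appears in a message of its own
  -- end.
  own := 0
  peer := rndx 1

/-- A server in a session with the client `honestClient`. -/
noncomputable def honestServer : RoleInstance :=
  { honestClient with role := .serverAuth, own := 1, peer := rndx 0 }

/-- The two ends of an undisturbed session. -/
noncomputable def honestStrand : Bool → Strand
  | true => ⟨.participant honestClient, 0⟩
  | false => ⟨.participant honestServer, 0⟩

/-- The messages of an undisturbed session. -/
noncomputable def honestSteps (M : Model) : List Step :=
  Role.clientAuth.steps M honestClient.vars

/-- The view of a step at either end. -/
def Step.event (b : Bool) (t : Step) : Event := if t.1 = b then .send t.2 else .recv t.2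

theorem Step.msg_event (b : Bool) (t : Step) : (t.event b).msg = t.2 := by
  unfold Step.event; split <;> rfl

theorem Step.event_eq_send {b : Bool} {t : Step} {m : Msg} : t.event b = .send m ↔ t = (b, m) := by
  rcases t with ⟨b', m'⟩
  unfold Step.event; split <;> simp_all

theorem Step.event_eq_recv {b : Bool} {t : Step} {m : Msg} :
    t.event b = .recv m ↔ t = (!b, m) := by
  rcases t with ⟨b', m'⟩
  cases b <;> cases b' <;> simp [Step.event]

theorem trace_honestStrand (b : Bool) :
    (honestStrand b).trace M = (honestSteps M).map (Step.event b) := by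
  have hc : Step.clientEvent = Step.event true := by
    funext ⟨b, m⟩; cases b <;> rfl
  have hs : Step.serverEvent = Step.event false := by
    funext ⟨b, m⟩; cases b <;> rfl
  cases b
  · rw [← hs]; rfl
  · rw [← hc]; rfl

theorem event?_honestStrand (b : Bool) (k : ℕ) :
    Node.event? M ⟨honestStrand b, k⟩ = ((honestSteps M)[k]?).map (Step.event b) := by
  simp [Node.event?, trace_honestStrand]

theorem honestStrand_injective : Function.Injective honestStrand := by
  intro b b' h
  cases b <;> cases b' <;> simp_all [honestStrand, honestServer, honestClient]

open Classical in
/-- An undisturbed session. -/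
noncomputable def honestBundle (M : Model) : Bundle M where
  height s := if ∃ b, s = honestStrand b then (s.trace M).length else 0
  height_le s := by split <;> simp
  finite := by
    refine (Set.finite_range honestStrand).subset fun s hs => ?_
    by_contra h
    have h' : ¬ ∃ b, s = honestStrand b := fun ⟨b, hb⟩ => h ⟨b, hb.symm⟩
    simp only [Set.mem_ofPred_eq, h', if_false, lt_irrefl] at hs
  deliver n n' := ∃ k b m, (honestSteps M)[k]? = some (b, m) ∧
    n = ⟨honestStrand b, k⟩ ∧ n' = ⟨honestStrand !b, k⟩
  deliver_spec := by
    rintro _ _ ⟨k, b, m, h, rfl, rfl⟩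
    have hk : k < (honestSteps M).length := (List.getElem?_eq_some_iff.1 h).1
    refine ⟨by simpa [trace_honestStrand] using hk, by simpa [trace_honestStrand] using hk, m, ?_⟩
    simp [event?_honestStrand, h, Step.event]
  existsUnique_sender := by
    rintro ⟨s, k⟩ hn m he
    obtain ⟨b, rfl⟩ : ∃ b, s = honestStrand b := by
      by_contra h
      simp only [h, if_false, not_lt_zero] at hn
    simp only [event?_honestStrand, Option.map_eq_some_iff, Step.event_eq_recv,
      exists_eq_right] at he
    refine ⟨⟨honestStrand !b, k⟩, ⟨k, !b, m, he, rfl, by simp⟩, ?_⟩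
    rintro _ ⟨k', b', m', h, rfl, h'⟩
    simp only [Node.mk.injEq] at h'
    obtain ⟨hb, rfl⟩ := h'
    rw [honestStrand_injective hb]
    simp
  acyclic := by
    -- The factor 2 makes a step along a strand increase the rank even from a reception to a
    -- transmission; a delivery keeps the index and gains the 1 of the reception.
    let rank : Node → ℕ := fun n =>
      2 * n.index + if ∃ m, n.event? M = some (.recv m) then 1 else 0
    suffices h : ∀ n n', Relation.TransGen (fun a b => (a.strand = b.strand ∧
        b.index = a.index + 1 ∧ b.index < (if ∃ c, b.strand = honestStrand c then
          (b.strand.trace M).length else 0)) ∨ (∃ k c m, (honestSteps M)[k]? = some (c, m) ∧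
        a = ⟨honestStrand c, k⟩ ∧ b = ⟨honestStrand !c, k⟩)) n n' → rank n < rank n' from
      fun n hn => lt_irrefl _ (h n n hn)
    have step : ∀ a b : Node, ((a.strand = b.strand ∧
        b.index = a.index + 1 ∧ b.index < (if ∃ c, b.strand = honestStrand c then
          (b.strand.trace M).length else 0)) ∨ (∃ k c m, (honestSteps M)[k]? = some (c, m) ∧
        a = ⟨honestStrand c, k⟩ ∧ b = ⟨honestStrand !c, k⟩)) → rank a < rank b := by
      rintro a b (⟨-, h, -⟩ | ⟨k, c, m, h, rfl, rfl⟩)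
      · simp only [rank, h]
        split_ifs <;> omega
      · simp [rank, event?_honestStrand, h, Step.event]
    intro n n' h
    induction h with
    | single h => exact step _ _ h
    | tail _ h ih => exact ih.trans (step _ _ h)

theorem hasNode_honestBundle {n : Node} :
    (honestBundle M).HasNode n ↔
      ∃ b k, n = ⟨honestStrand b, k⟩ ∧ k < (honestSteps M).length := by
  rcases n with ⟨s, k⟩
  by_cases h : ∃ b, s = honestStrand b
  · obtain ⟨b, rfl⟩ := h
    simp [Bundle.HasNode, honestBundle, trace_honestStrand, honestStrand_injective.eq_iff]
  · simp only [Bundle.HasNode, honestBundle, h, if_false, Node.mk.injEq, not_lt_zero, false_iff]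
    rintro ⟨b, k, ⟨hb, -⟩, -⟩
    exact h ⟨b, hb⟩

theorem forall_msg_honestBundle {P : Msg → Prop} (h : ∀ t ∈ honestSteps M, P t.2) :
    ∀ n, (honestBundle M).HasNode n → ∀ e, n.event? M = some e → P e.msg := by
  intro n hn e he
  obtain ⟨b, k, rfl, -⟩ := hasNode_honestBundle.1 hn
  simp only [event?_honestStrand, Option.map_eq_some_iff] at he
  obtain ⟨t, ht, rfl⟩ := he
  rw [Step.msg_event]
  exact h t (List.mem_of_getElem? ht)

/-- The first message with a given property is first sent at a unique node. -/
theorem first_honestBundle {P : Msg → Prop} {k : ℕ} {b : Bool} {m : Msg}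
    (hk : (honestSteps M)[k]? = some (b, m)) (hm : P m)
    (hlt : ∀ l < k, ∀ t, (honestSteps M)[l]? = some t → ¬ P t.2) :
    ∃ n, n.strand = honestStrand b ∧ (honestBundle M).HasNode n ∧
      ((∃ m, n.event? M = some (.send m) ∧ P m) ∧
        ∀ k < n.index, ∀ e, Node.event? M ⟨n.strand, k⟩ = some e → ¬ P e.msg) ∧
      ∀ n', (honestBundle M).HasNode n' → ((∃ m, n'.event? M = some (.send m) ∧ P m) ∧
        ∀ k < n'.index, ∀ e, Node.event? M ⟨n'.strand, k⟩ = some e → ¬ P e.msg) → n' = n := by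
  refine ⟨⟨honestStrand b, k⟩, rfl,
    hasNode_honestBundle.2 ⟨b, k, rfl, (List.getElem?_eq_some_iff.1 hk).1⟩, ⟨⟨m, ?_, hm⟩, ?_⟩, ?_⟩
  · simp [event?_honestStrand, hk, Step.event]
  · intro l hl e he
    simp only [event?_honestStrand, Option.map_eq_some_iff] at he
    obtain ⟨t, ht, rfl⟩ := he
    rw [Step.msg_event]
    exact hlt l hl t ht
  · rintro n' hn ⟨⟨m', h1, h2⟩, h3⟩
    obtain ⟨b', k', rfl, -⟩ := hasNode_honestBundle.1 hn
    simp only [event?_honestStrand, Option.map_eq_some_iff, Step.event_eq_send,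
      exists_eq_right] at h1
    rcases lt_trichotomy k' k with h | rfl | h
    · exact absurd h2 (hlt k' h _ h1)
    · rw [hk] at h1
      cases h1
      rfl
    -- Both ends share the list of steps, so either strand already shows `m` at the earlier index
    -- `k`.
    · refine absurd hm ?_
      have := h3 k h (Step.event b' (b, m))
      rw [Step.msg_event] at this
      exact this (by simp [event?_honestStrand, hk])

theorem not_hasRndx_helloExtension {i : ℕ} {v : Vars} : ¬ (helloExtension M v).HasRndx i := by
  cases M <;> simp [helloExtension, bindingKey, HasRndx, pubk, privk]

theorem not_priv_carriedBy_helloExtension {κ : KeyPair} {v : Vars} :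
    ¬ (priv κ).CarriedBy (helloExtension M v) := by
  intro h; simpa [pubk] using carriedBy_helloExtension h

theorem honestSteps_tls12 {x : KeyExchange} (h : M.tls = x.tls) :
    honestSteps M = TLS12.handshake M x honestClient.vars ++ authentication M honestClient.vars := by
  simp [honestSteps, Role.steps, handshake_tls12 h]

theorem honestSteps_tls13 (h : M.tls = .tls13) :
    honestSteps M = TLS13.handshake M honestClient.vars ++ authentication M honestClient.vars := by
  simp [honestSteps, Role.steps, handshake_tls13 h]

/-- Private keys occur only in key position, which is not carried. -/
theorem not_priv_carriedBy_honestSteps (κ : KeyPair) :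
    (honestBundle M).NonOriginating (priv κ) := by
  refine forall_msg_honestBundle (P := fun m => ¬ (priv κ).CarriedBy m) ?_
  rcases M.tls_cases with ⟨x, h⟩ | h
  · cases x <;>
      simp [honestSteps_tls12 h, TLS12.handshake, authentication, TLS12.clientHello,
        TLS12.serverHello, TLS12.clientKeyExchange, TLS12.clientFinished, TLS12.serverFinished,
        certificate, finalChallenge, pubk, not_priv_carriedBy_helloExtension]
  · simp [honestSteps_tls13 h, TLS13.handshake, authentication, TLS13.clientHello,
        TLS13.serverHello, TLS13.certificateVerify, TLS13.clientFinished, TLS13.serverFinished,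
        certificate, finalChallenge, pubk, not_priv_carriedBy_helloExtension]

theorem vars_honestClient : honestClient.vars.cr = 0 ∧ honestClient.vars.sr = 1 ∧
    honestClient.vars.pms = 0 ∧ honestClient.vars.x = rndx 0 ∧ honestClient.vars.y = rndx 1 :=
  ⟨rfl, rfl, rfl, rfl, rfl⟩

theorem serversFresh_honestBundle : (honestBundle M).ServersFresh := by
  rintro hM s p hs hp ⟨k, m, hn, -, -⟩
  obtain ⟨b, _, hb, -⟩ := hasNode_honestBundle.1 hn
  obtain rfl : s = honestStrand b := (Node.mk.inj hb).1
  obtain ⟨-, -, -, hx, hy⟩ := vars_honestClient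
  cases b
  · cases hs
    rcases M.tls_cases with ⟨x, h⟩ | h
    · cases x
      · exact absurd h hM
      refine first_honestBundle (P := HasRndx 1) (k := 1) (b := false)
        (by rw [honestSteps_tls12 h]; rfl) ?_ ?_
      · simp [TLS12.serverHello, HasRndx, hy, rndx]
      · simp [honestSteps_tls12 h, TLS12.handshake, TLS12.clientHello, HasRndx,
          not_hasRndx_helloExtension]
    · refine first_honestBundle (P := HasRndx 1) (k := 1) (b := false)
        (by rw [honestSteps_tls13 h]; rfl) ?_ ?_
      · simp [TLS13.serverHello, HasRndx, hy, rndx]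
      · simp [honestSteps_tls13 h, TLS13.handshake, TLS13.clientHello, HasRndx, hx, rndx,
          not_hasRndx_helloExtension]
  · cases hs
    exact hp.elim

theorem clientAssumptions_honestBundle :
    clientAssumptions M (honestBundle M) (honestStrand true) honestClient := by
  obtain ⟨hcr, hsr, hpms, hx, hy⟩ := vars_honestClient
  refine ⟨not_priv_carriedBy_honestSteps _, not_priv_carriedBy_honestSteps _,
    not_priv_carriedBy_honestSteps _, ?_, fun h => ?_, fun hM => ?_⟩
  · rcases M.tls_cases with ⟨x, h⟩ | h
    · exact first_honestBundle (P := (random32 0).CarriedBy) (k := 0) (b := true)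
        (by rw [honestSteps_tls12 h]; rfl) (by simp [TLS12.clientHello, hcr]) (by simp)
    · exact first_honestBundle (P := (random32 0).CarriedBy) (k := 0) (b := true)
        (by rw [honestSteps_tls13 h]; rfl) (by simp [TLS13.clientHello, hcr]) (by simp)
  · refine first_honestBundle (P := (random48 0).CarriedBy) (k := 2) (b := true)
      (by rw [honestSteps_tls12 (x := .rsa) h]; rfl)
      (by simp [TLS12.clientKeyExchange, hpms]) fun l hl => ?_
    obtain rfl | rfl : l = 0 ∨ l = 1 := by omega
    all_goals simp [honestSteps_tls12 (x := .rsa) h, TLS12.handshake, TLS12.clientHello,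
      TLS12.serverHello, certificate, pubk]
  · rcases M.tls_cases with ⟨x, h⟩ | h
    · cases x
      · exact absurd h hM
      refine first_honestBundle (P := HasRndx 0) (k := 2) (b := true)
        (by rw [honestSteps_tls12 h]; rfl)
        (by simp [TLS12.clientKeyExchange, HasRndx, hx, rndx]) fun l hl => ?_
      obtain rfl | rfl : l = 0 ∨ l = 1 := by omega
      all_goals simp [honestSteps_tls12 h, TLS12.handshake, TLS12.clientHello,
        TLS12.serverHello, certificate, pubk, privk, HasRndx, hy, rndx, not_hasRndx_helloExtension]
    · exact first_honestBundle (P := HasRndx 0) (k := 0) (b := true)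
        (by rw [honestSteps_tls13 h]; rfl)
        (by simp [TLS13.clientHello, HasRndx, hx, rndx]) (by simp)

/-- Only the role of a server in authentication is guaranteed as the partner of a client. -/
theorem Succ.eq_serverAuth {R : Role} {Ctx : SessionContext} {j : ℕ}
    (h : Succ M .clientAuth R Ctx (clientAssumptions M) (Role.clientAuth.height M) j) :
    R = .serverAuth := by
  have hlen : (honestBundle M).height (honestStrand true) = Role.clientAuth.height M := by
    rw [← Role.length_trace M honestClient.vars]
    simp only [honestBundle, exists_apply_eq_apply', if_true]
    rfl
  have hpos : 0 < Role.clientAuth.height M := by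
    unfold Role.height; split <;> omega
  obtain ⟨s, q, hs, rfl, hc, hb, -⟩ := h (honestBundle M) serversFresh_honestBundle
    (honestStrand true) honestClient rfl rfl (hpos.trans_le hlen.ge) hlen.ge
    clientAssumptions_honestBundle
  obtain ⟨b, _, hb, -⟩ := hasNode_honestBundle.1
    (show (honestBundle M).HasNode ⟨s, 0⟩ from hb)
  obtain rfl : s = honestStrand b := (Node.mk.inj hb).1
  -- The session has two strands: the server, as wanted, and the client itself, which is not
  -- complementary to a client.
  cases b
  · cases hs; rfl
  · cases hs
    simp [Role.Complementary, honestClient, Role.IsClient, Role.IsServer] at hc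

/-! ### Agreement and uniqueness of the partner -/

theorem four_lt_height (r : Role) : 4 < r.height M := by
  unfold Role.height; split <;> omega

theorem sessionContextAgreementAt_clientAuth {j : ℕ} (hj : j + 1 = Role.serverAuth.height M) :
    SessionContextAgreementAt M .clientAuth .serverAuth (authContext M) (clientAssumptions M) j := by
  refine ⟨by omega, ?_, fun Rb Rc h => h.1.eq_serverAuth.trans h.2.eq_serverAuth.symm⟩
  intro B hB s p hs hp _ hh hA
  obtain ⟨t, q, hq, hqr, hqh, hctx⟩ := Bundle.exists_partner hB hs hp (hp ▸ hh) hA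
  rw [hqr, ← hj] at hqh
  have := four_lt_height (M := M) .serverAuth
  exact ⟨t, q, hq, hqr, .inl ⟨trivial, trivial⟩, show 0 < B.height t by omega, by omega, hctx⟩

/-- Each side is pinned down by a fresh value that is part of the context: the client by its random,
the server by its random (RSA) or by its exponent (DH). At height `j` a server has passed its second
node, where that value first appears. -/
theorem uniquePartner_clientAuth {j : ℕ} (hj : j + 1 = Role.serverAuth.height M) :
    UniquePartner M .clientAuth .serverAuth (authContext M)
      (fun B s p => clientAssumptions M B s p ∧
        (M.tls = .tls12RSA → freshServerRandom M B s p)) j := by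
  rintro B hB s p hs hp hh ⟨hA, hsr⟩
  obtain ⟨t, q, hq, hqr, hqh, hctx⟩ := Bundle.exists_partner hB hs hp (hp ▸ hh) hA
  rw [hqr, ← hj] at hqh
  have h4 := four_lt_height (M := M) .serverAuth
  refine ⟨t, q, hq, hqr, .inl ⟨trivial, trivial⟩, show 0 < B.height t by omega, by omega, hctx,
    ?_, ?_⟩
  · intro u r hu hr _ hju hur
    have hrs : r.role.IsServer := by simpa [Role.Complementary, Role.IsClient, Role.IsServer] using hr
    have hqs : q.role.IsServer := by rw [hqr]; trivial
    have hbu : B.HasNode ⟨u, 1⟩ := show 1 < B.height u by omega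
    have hbt : B.HasNode ⟨t, 1⟩ := show 1 < B.height t by omega
    obtain ⟨⟨-, -, hc₁, hs₁, -, hd₁⟩, -⟩ := hctx
    obtain ⟨⟨-, -, hc₂, hs₂, -, hd₂⟩, -⟩ := hur
    by_cases hM : M.tls = .tls12RSA
    · obtain ⟨w, hws, hw⟩ := hsr hM
      -- The client random originates only on `s`, the server random on another strand.
      have hne : p.sr ≠ p.cr := by
        intro h
        obtain ⟨n, rfl, -, -, hn⟩ := hA.2.2.2.1
        obtain ⟨n', rfl, hb', ho', -⟩ := hw
        rw [h] at ho'
        exact hws (by rw [hn n' hb' ho'])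
      rw [Bundle.UniquelyOriginates.server_eq (hs₂ ▸ hw) hu hrs (by rwa [← hs₂, ← hc₂]) hbu,
        Bundle.UniquelyOriginates.server_eq (hs₁ ▸ hw) hq hqs (by rwa [← hs₁, ← hc₁]) hbt]
    · have hy : q.own = r.own := by
        apply rndx_injective
        rw [← RoleInstance.y_of_isServer hqs, ← RoleInstance.y_of_isServer hrs,
          ← (hd₁ hM).2, (hd₂ hM).2]
      have hgt := hB.uniquelyGenerates hM hq hqs hbt
      rw [hy] at hgt
      exact hgt.strand_eq (hB.uniquelyGenerates hM hu hrs hbu)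
  · intro u r hu hr hbu hur
    have hrc : r.role.IsClient := by simpa [Role.Complementary, Role.IsClient, Role.IsServer] using hr
    refine Bundle.UniquelyOriginates.client_eq (p := r) ?_ hu hrc hbu
    rw [hur.1.2.2.1, ← hctx.1.2.2.1]
    exact hA.2.2.2.1

end UAF

theorem theorem4 (M : UAF.Model) :
    UAF.SessionContextAgreement M .clientAuth .serverAuth (UAF.authContext M)
      (UAF.clientAssumptions M) ∧
    ∃ j, j + 1 = UAF.Role.serverAuth.height M ∧
      UAF.SessionContextAgreementAt M .clientAuth .serverAuth (UAF.authContext M)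
        (UAF.clientAssumptions M) j ∧
      UAF.UniquePartner M .clientAuth .serverAuth (UAF.authContext M)
        (fun B s p => UAF.clientAssumptions M B s p ∧
          (M.tls = .tls12RSA → UAF.freshServerRandom M B s p)) j := by
  obtain ⟨j, hj⟩ : ∃ j, j + 1 = UAF.Role.serverAuth.height M :=
    ⟨_, Nat.succ_pred_eq_of_pos (Nat.zero_lt_of_lt (UAF.four_lt_height .serverAuth))⟩
  have h := UAF.sessionContextAgreementAt_clientAuth hj
  exact ⟨⟨j, h⟩, j, hj, h, UAF.uniquePartner_clientAuth hj⟩
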